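/- Let $m,k,p\ge 0$ be integers, $n=m+k$, and consider for $t\in[0,\infty)$ the linear time-varying system $$\begin{bmatrix}\dot x_1\\ \dot x_2\end{bmatrix}=B(t)\begin{bmatrix}x_1\\x_2\end{bmatrix},\quad B(t)=\begin{bmatrix}B_{11}(t)&B_{12}(t)\\0&B_{22}(t)\end{bmatrix},\qquad y=C(t)\begin{bmatrix}x_1\\x_2\end{bmatrix},\quad C(t)=\begin{bmatrix}C_1(t)&C_2(t)\end{bmatrix},$$ with $x_1(t)\in\mathbb R^{m}$, $x_2(t)\in\mathbb R^k$, $y(t)\in\mathbb R^p$, where $B_{11},B_{12},B_{22},C_1,C_2$ are continuous and uniformly bounded on $[0,\infty)$. Matrix norms are induced by the Euclidean norm. A fundamental matrix of $\dot x=A(t)x$ is a solution $X$ of $\dot X=A(t)X$ on $[0,\infty)$ with $X(t)$ nonsingular (solutions are classical if $A$ is continuous, and in the sense of Carathéodory otherwise); the transition matrix is $\Phi(t,t_0)=X(t)X(t_0)^{-1}$. Assume that $\dot x=B(t)x$ admits an exponential dichotomy with projection $P=\begin{bmatrix}0&0\\0&I_k\end{bmatrix}$ and a block upper triangular fundamental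 matrix $X(t)$ (partitioned as $B(t)$): there are $K\ge1$, $\alpha>0$ with $$\|X(t)PX(t_0)^{-1}\|\le Ke^{-\alpha(t-t_0)}\ \ (t\ge t_0\ge0),\qquad \|X(t)(I_n-P)X(t_0)^{-1}\|\le Ke^{\alpha(t-t_0)}\ \ (0\le t\le t_0).$$ Then the system is uniformly exponentially detectable if and only if the pair $(B_{11},C_1)$ is uniformly completely observable. Here: * the system is uniformly exponentially detectable if there is a uniformly bounded gain $L:[0,\infty)\to\mathbb R^{n\times p}$ such that $\dot e=[B(t)-L(t)C(t)]e$ is uniformly exponentially stable, i.e. it has a transition matrix $\Phi_e$, and $\|\Phi_e(t,t_0)\|\le K_e e^{-\mu(t-t_0)}$ for all $t\ge t_0\ge0$ with some constants $K_e\ge1$, $\mu>0$; * $(B_{11},C_1)$ is uniformly completely observable if there are constants $\beta_1,\beta_2,\sigma>0$ such that for all $t_0\ge0$ $$\beta_1I_m\preceq\int_{t_0}^{t_0+\sigma}\Phi_{11}(s,t_0)^{\mathsf T}C_1(s)^{\mathsf T}C_1(s)\Phi_{11}(s,t_0)\,ds\preceq\beta_2I_m,$$ where $\Phi_{11}$ is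 the transition matrix of $\dot x_1=B_{11}(t)x_1$. The same equivalence holds if, in the definition of uniform exponential detectability, the gain $L$ is required to be continuous as well. -/

import Mathlib

open Set MeasureTheory
open scoped Matrix Matrix.Norms.L2Operator

/-- Uniform boundedness on `[0, ∞)`; the norm of a matrix is the one induced by the
Euclidean norms. -/
def UniformlyBounded {ι κ : Type*} [Fintype ι] [Fintype κ] [DecidableEq κ]
    (M : ℝ → Matrix ι κ ℝ) : Prop :=
  ∃ c : ℝ, ∀ t : ℝ, 0 ≤ t → ‖M t‖ ≤ c

/-- `X` is a fundamental matrix solution on `[0, ∞)` of `x' = A(t) x`: a nonsingular solution of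
`X' = A X`. Solutions are understood in the sense of Carathéodory, i.e. through
`X(t) = X(0) + ∫₀ᵗ A(s) X(s) ds`; for continuous `A` these are exactly the classical `C¹`
solutions. -/
def IsFundamentalMatrix {ι : Type*} [Fintype ι] [DecidableEq ι]
    (A X : ℝ → Matrix ι ι ℝ) : Prop :=
  ContinuousOn X (Ici 0) ∧
  (∀ t : ℝ, 0 ≤ t → IsUnit (X t)) ∧
  (∀ t : ℝ, 0 ≤ t → IntervalIntegrable (fun s => A s * X s) volume 0 t) ∧
  (∀ t : ℝ, 0 ≤ t → X t = X 0 + ∫ s in (0 : ℝ)..t, A s * X s)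

/-- The state transition matrix `Φ(t, t₀) = X(t) X(t₀)⁻¹` obtained from a fundamental matrix. -/
noncomputable def transitionMatrix {ι : Type*} [Fintype ι] [DecidableEq ι]
    (X : ℝ → Matrix ι ι ℝ) (t t₀ : ℝ) : Matrix ι ι ℝ :=
  X t * (X t₀)⁻¹

/-- The system `x' = A(t) x` is uniformly exponentially stable. -/
def UniformlyExponentiallyStable {ι : Type*} [Fintype ι] [DecidableEq ι]
    (A : ℝ → Matrix ι ι ℝ) : Prop :=
  ∃ X : ℝ → Matrix ι ι ℝ, IsFundamentalMatrix A X ∧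
    ∃ μ K : ℝ, 0 < μ ∧ 1 ≤ K ∧
      ∀ t₀ t : ℝ, 0 ≤ t₀ → t₀ ≤ t →
        ‖transitionMatrix X t t₀‖ ≤ K * Real.exp (-μ * (t - t₀))

/-- The pair `(A, C)` is uniformly exponentially detectable: some uniformly bounded gain `L` makes
`e' = (A - L C) e` uniformly exponentially stable. -/
def UniformlyExponentiallyDetectable {ι ο : Type*} [Fintype ι] [DecidableEq ι]
    [Fintype ο] [DecidableEq ο]
    (A : ℝ → Matrix ι ι ℝ) (C : ℝ → Matrix ο ι ℝ) : Prop :=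
  ∃ L : ℝ → Matrix ι ο ℝ, UniformlyBounded L ∧
    UniformlyExponentiallyStable (fun t => A t - L t * C t)

/-- Uniform exponential detectability by means of a continuous gain. -/
def UniformlyExponentiallyDetectableCont {ι ο : Type*} [Fintype ι] [DecidableEq ι]
    [Fintype ο] [DecidableEq ο]
    (A : ℝ → Matrix ι ι ℝ) (C : ℝ → Matrix ο ι ℝ) : Prop :=
  ∃ L : ℝ → Matrix ι ο ℝ, ContinuousOn L (Ici 0) ∧ UniformlyBounded L ∧
    UniformlyExponentiallyStable (fun t => A t - L t * C t)

/-- The system `x' = A(t) x` has an exponential dichotomy on `[0, ∞)` with the projection matrix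
`P` and the fundamental matrix solution `X`. -/
def ExponentialDichotomyWith {ι : Type*} [Fintype ι] [DecidableEq ι]
    (A X : ℝ → Matrix ι ι ℝ) (P : Matrix ι ι ℝ) : Prop :=
  IsFundamentalMatrix A X ∧ P * P = P ∧
    ∃ K α : ℝ, 1 ≤ K ∧ 0 < α ∧
      (∀ t t₀ : ℝ, 0 ≤ t₀ → t₀ ≤ t →
        ‖X t * P * (X t₀)⁻¹‖ ≤ K * Real.exp (-α * (t - t₀))) ∧
      (∀ t t₀ : ℝ, 0 ≤ t → t ≤ t₀ →
        ‖X t * (1 - P) * (X t₀)⁻¹‖ ≤ K * Real.exp (α * (t - t₀)))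

/-- The observability Gramian `M(t₁, t₀)` of the output `C(t) x`, where `X` is a fundamental matrix
of the system. -/
noncomputable def observabilityGramian {ι ο : Type*} [Fintype ι] [DecidableEq ι]
    [Fintype ο] (X : ℝ → Matrix ι ι ℝ) (C : ℝ → Matrix ο ι ℝ) (t₁ t₀ : ℝ) : Matrix ι ι ℝ :=
  ∫ s in t₀..t₁, (transitionMatrix X s t₀)ᵀ * (C s)ᵀ * C s * transitionMatrix X s t₀

/-- The pair `(A, C)` is uniformly completely observable. -/
def UniformlyCompletelyObservable {ι ο : Type*} [Fintype ι] [DecidableEq ι]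
    [Fintype ο] (A : ℝ → Matrix ι ι ℝ) (C : ℝ → Matrix ο ι ℝ) : Prop :=
  ∃ X : ℝ → Matrix ι ι ℝ, IsFundamentalMatrix A X ∧
    ∃ β₁ β₂ σ : ℝ, 0 < β₁ ∧ 0 < β₂ ∧ 0 < σ ∧
      ∀ t₀ : ℝ, 0 ≤ t₀ →
        (observabilityGramian X C (t₀ + σ) t₀ - β₁ • (1 : Matrix ι ι ℝ)).PosSemidef ∧
        (β₂ • (1 : Matrix ι ι ℝ) - observabilityGramian X C (t₀ + σ) t₀).PosSemidef

/-!
The projection `P` of the dichotomy splits the block triangular system into its first diagonal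
block, all of whose trajectories expand exponentially (`norm_transitionMatrix_toBlocks₁₁_le`), and
its second one, which is exponentially stable (`norm_transitionMatrix_toBlocks₂₂_le`). Only the
first block needs output injection.

*Detectability implies observability.* A trajectory starting in the first block stays there and
expands, while the error system of the observer contracts. Over a fixed time `σ` the two trajectories
with the same initial value `v` are therefore at least `|v|` apart. They solve differential
equations that differ by the bounded term `L C x`, so Grönwall's inequality bounds their distance
by a multiple of the integral of the output norm (`norm_sub_le_integral_output`), and Cauchy–Schwarz
turns this into a lower bound on the output energy, which is the quadratic form of the Gramian. The
gain need not be measurable: only the norms of the integrands are estimated, and for these there are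
continuous bounds. See `uniformlyCompletelyObservable_of_detectable`.

*Observability implies detectability.* Let `Y` be a fundamental matrix of the first block with
transition matrix `Φ`, and let `N(t) = 1 + ∫₀ᵗ Yᵀ C₁ᵀ C₁ Y` and `W = Y⁻ᵀ N Y⁻¹`. For the gain
`L₁ = W⁻¹ C₁ᵀ`, a fundamental matrix of the error system `e' = (B₁₁ - L₁ C₁) e` is known explicitly,
namely `Y N⁻¹`, and its transition matrix is `W(t)⁻¹ Φ(s,t)ᵀ W(s)`. Observability bounds `W` from
below (`exists_le_currentInformation`), antistability bounds it from above
(`exists_norm_currentInformation_le`) and makes `Φ(s,t)` decay in `t - s`; so the error system is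
exponentially stable (`exists_stabilizing_gain`). With the gain `[L₁; 0]` the full error system is a
cascade of this system and the stable second block, hence stable
(`uniformlyExponentiallyStable_fromBlocks`). This gain is continuous, so that both variants of
detectability are equivalent to observability.
-/

namespace LTV

set_option linter.unusedSectionVars false

/-! ### Matrices with the norm induced by the Euclidean norms -/

section Matrices

variable {ι κ ν ρ : Type*} [Fintype ι] [DecidableEq ι] [Fintype κ] [DecidableEq κ]
  [Fintype ν] [DecidableEq ν] [Fintype ρ] [DecidableEq ρ]

lemma norm_sq_toLp (x : ι → ℝ) : ‖WithLp.toLp 2 x‖ ^ 2 = x ⬝ᵥ x := by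
  rw [EuclideanSpace.norm_sq_eq]
  simp [dotProduct, sq]

lemma zero_le_dotProduct_self (x : ι → ℝ) : 0 ≤ x ⬝ᵥ x := by
  rw [← norm_sq_toLp]; positivity

lemma dotProduct_mulVec_self_le (M : Matrix ι κ ℝ) (x : κ → ℝ) :
    (M *ᵥ x) ⬝ᵥ (M *ᵥ x) ≤ ‖M‖ ^ 2 * (x ⬝ᵥ x) := by
  rw [← norm_sq_toLp, ← norm_sq_toLp, ← mul_pow]
  exact pow_le_pow_left₀ (norm_nonneg _) (Matrix.l2_opNorm_mulVec M (WithLp.toLp 2 x)) 2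

lemma norm_le_of_dotProduct_mulVec_self_le {M : Matrix ι κ ℝ} {c : ℝ} (hc : 0 ≤ c)
    (h : ∀ x, (M *ᵥ x) ⬝ᵥ (M *ᵥ x) ≤ c ^ 2 * (x ⬝ᵥ x)) : ‖M‖ ≤ c := by
  rw [Matrix.l2_opNorm_def]
  refine ContinuousLinearMap.opNorm_le_bound _ hc fun x => ?_
  have := h x.ofLp
  rw [← norm_sq_toLp, ← norm_sq_toLp, ← mul_pow] at this
  exact (sq_le_sq₀ (norm_nonneg _) (by positivity)).1 this

lemma norm_transpose (M : Matrix ι κ ℝ) : ‖Mᵀ‖ = ‖M‖ := by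
  rw [← Matrix.l2_opNorm_conjTranspose M, Matrix.conjTranspose_eq_transpose_of_trivial]

lemma norm_one_le : ‖(1 : Matrix ι ι ℝ)‖ ≤ 1 :=
  norm_le_of_dotProduct_mulVec_self_le zero_le_one fun x => by simp

/-- The norm of a column matrix is the Euclidean norm of the column. -/
lemma norm_replicateCol_sq (x : ι → ℝ) : ‖Matrix.replicateCol Unit x‖ ^ 2 = x ⬝ᵥ x := by
  have h : (Matrix.replicateCol Unit x)ᴴ * Matrix.replicateCol Unit x =
      Matrix.diagonal fun _ : Unit => x ⬝ᵥ x := by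
    ext i j
    simp [Matrix.mul_apply, dotProduct, Matrix.diagonal]
  rw [sq, ← Matrix.l2_opNorm_conjTranspose_mul_self, h, Matrix.l2_opNorm_diagonal,
    pi_norm_const, Real.norm_of_nonneg (zero_le_dotProduct_self x)]

lemma isBoundedBilinearMap_mul :
    IsBoundedBilinearMap ℝ fun q : Matrix ι κ ℝ × Matrix κ ν ℝ => q.1 * q.2 where
  add_left := Matrix.add_mul
  smul_left c A B := Matrix.smul_mul c A B
  add_right := Matrix.mul_add
  smul_right c A B := Matrix.mul_smul A c B
  bound := ⟨1, one_pos, fun A B => by simpa using Matrix.l2_opNorm_mul A B⟩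

lemma _root_.HasDerivAt.matrix_mul {A : ℝ → Matrix ι κ ℝ} {B : ℝ → Matrix κ ν ℝ}
    {A' : Matrix ι κ ℝ} {B' : Matrix κ ν ℝ} {t : ℝ} (hA : HasDerivAt A A' t)
    (hB : HasDerivAt B B' t) :
    HasDerivAt (fun s => A s * B s) (A' * B t + A t * B') t := by
  have := (isBoundedBilinearMap_mul.hasFDerivAt (A t, B t)).comp_hasDerivAt t (hA.prodMk hB)
  convert! this using 1
  simp [add_comm]

lemma _root_.ContinuousOn.matrix_mul {A : ℝ → Matrix ι κ ℝ} {B : ℝ → Matrix κ ν ℝ} {s : Set ℝ}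
    (hA : ContinuousOn A s) (hB : ContinuousOn B s) : ContinuousOn (fun t => A t * B t) s :=
  isBoundedBilinearMap_mul.continuous.comp_continuousOn (hA.prodMk hB)

lemma _root_.ContinuousOn.matrix_transpose {A : ℝ → Matrix ι κ ℝ} {s : Set ℝ}
    (hA : ContinuousOn A s) : ContinuousOn (fun t => (A t)ᵀ) s :=
  (continuous_id.matrix_transpose).comp_continuousOn hA

/-- Left and right multiplication by fixed matrices, as a continuous linear map. -/
noncomputable def mulMulCLM (P : Matrix ι κ ℝ) (Q : Matrix ν ρ ℝ) :
    Matrix κ ν ℝ →L[ℝ] Matrix ι ρ ℝ :=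
  LinearMap.mkContinuous
    { toFun := fun M => P * M * Q
      map_add' := fun A B => by rw [Matrix.mul_add, Matrix.add_mul]
      map_smul' := fun c A => by simp } (‖P‖ * ‖Q‖) fun M => by
    calc ‖P * M * Q‖ ≤ ‖P * M‖ * ‖Q‖ := Matrix.l2_opNorm_mul _ _
      _ ≤ ‖P‖ * ‖M‖ * ‖Q‖ := by gcongr; exact Matrix.l2_opNorm_mul _ _
      _ = ‖P‖ * ‖Q‖ * ‖M‖ := by ring

instance : CompleteSpace (Matrix ι κ ℝ) := FiniteDimensional.complete ℝ _

lemma integral_mul_mul (P : Matrix ι κ ℝ) (Q : Matrix ν ρ ℝ) {f : ℝ → Matrix κ ν ℝ} {a b : ℝ}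
    (hf : IntervalIntegrable f volume a b) :
    ∫ s in a..b, P * f s * Q = P * (∫ s in a..b, f s) * Q :=
  (mulMulCLM P Q).intervalIntegral_comp_comm hf

lemma _root_.IntervalIntegrable.mul_mul (P : Matrix ι κ ℝ) (Q : Matrix ν ρ ℝ)
    {f : ℝ → Matrix κ ν ℝ} {a b : ℝ} (hf : IntervalIntegrable f volume a b) :
    IntervalIntegrable (fun s => P * f s * Q) volume a b :=
  ⟨(mulMulCLM P Q).integrable_comp hf.1, (mulMulCLM P Q).integrable_comp hf.2⟩

lemma integral_matrix_mul_const (Q : Matrix ν ρ ℝ) {f : ℝ → Matrix κ ν ℝ} {a b : ℝ}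
    (hf : IntervalIntegrable f volume a b) :
    ∫ s in a..b, f s * Q = (∫ s in a..b, f s) * Q := by
  simpa using integral_mul_mul (1 : Matrix κ κ ℝ) Q hf

lemma _root_.IntervalIntegrable.matrix_mul_const (Q : Matrix ν ρ ℝ)
    {f : ℝ → Matrix κ ν ℝ} {a b : ℝ} (hf : IntervalIntegrable f volume a b) :
    IntervalIntegrable (fun s => f s * Q) volume a b := by
  simpa using hf.mul_mul (1 : Matrix κ κ ℝ) Q

/-- The quadratic form of an integral is the integral of the quadratic forms. -/
lemma dotProduct_integral_mulVec {f : ℝ → Matrix ι ι ℝ} {a b : ℝ}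
    (hf : IntervalIntegrable f volume a b) (x : ι → ℝ) :
    x ⬝ᵥ (∫ s in a..b, f s) *ᵥ x = ∫ s in a..b, x ⬝ᵥ f s *ᵥ x := by
  let q : Matrix ι ι ℝ →ₗ[ℝ] ℝ :=
    { toFun := fun M => x ⬝ᵥ M *ᵥ x
      map_add' := fun A B => by rw [Matrix.add_mulVec, dotProduct_add]
      map_smul' := fun c A => by simp [Matrix.smul_mulVec, dotProduct_smul] }
  exact (q.toContinuousLinearMap.intervalIntegral_comp_comm hf).symm

/-- `xᵀ Mᵀ M x = |M x|²`. -/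
lemma dotProduct_transpose_mul_self (M : Matrix ι κ ℝ) (x : κ → ℝ) :
    x ⬝ᵥ (Mᵀ * M) *ᵥ x = (M *ᵥ x) ⬝ᵥ (M *ᵥ x) := by
  rw [← Matrix.mulVec_mulVec, Matrix.dotProduct_mulVec, Matrix.vecMul_transpose]

lemma integral_isHermitian {f : ℝ → Matrix ι ι ℝ} {a b : ℝ}
    (hf : IntervalIntegrable f volume a b) (hs : ∀ s, (f s)ᵀ = f s) :
    (∫ s in a..b, f s).IsHermitian := by
  let T : Matrix ι ι ℝ →ₗ[ℝ] Matrix ι ι ℝ := (Matrix.transposeLinearEquiv ι ι ℝ ℝ).toLinearMap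
  have h := T.toContinuousLinearMap.intervalIntegral_comp_comm hf
  have h2 : ∀ s, T.toContinuousLinearMap (f s) = f s := hs
  simp_rw [h2] at h
  rw [Matrix.IsHermitian, Matrix.conjTranspose_eq_transpose_of_trivial]
  exact h.symm

/-- A matrix whose quadratic form is bounded below by `c > 0` is invertible, and its inverse has
norm at most `1 / c`. -/
lemma isUnit_and_norm_inv_le {W : Matrix ι ι ℝ} {c : ℝ} (hc : 0 < c)
    (h : ∀ x, c * (x ⬝ᵥ x) ≤ x ⬝ᵥ W *ᵥ x) : IsUnit W ∧ ‖W⁻¹‖ ≤ c⁻¹ := by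
  have hCS : ∀ x, c ^ 2 * (x ⬝ᵥ x) ≤ (W *ᵥ x) ⬝ᵥ (W *ᵥ x) := by
    intro x
    have h0 := zero_le_dotProduct_self (W *ᵥ x - c • x)
    have h1 := h x
    simp only [dotProduct_sub, sub_dotProduct, dotProduct_smul, smul_dotProduct, smul_eq_mul]
      at h0
    rw [dotProduct_comm (W *ᵥ x) x] at h0
    have := mul_le_mul_of_nonneg_left h1 hc.le
    nlinarith
  have hu : IsUnit W := by
    rw [← Matrix.mulVec_injective_iff_isUnit]
    intro x y hxy
    have h1 := hCS (x - y)
    rw [Matrix.mulVec_sub, sub_eq_zero.2 hxy, zero_dotProduct] at h1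
    have h2 : (x - y) ⬝ᵥ (x - y) ≤ 0 := by
      by_contra hlt
      have : 0 < c ^ 2 * ((x - y) ⬝ᵥ (x - y)) := by push Not at hlt; positivity
      linarith
    have h3 := le_antisymm h2 (zero_le_dotProduct_self _)
    exact sub_eq_zero.1 (dotProduct_self_eq_zero.1 h3)
  refine ⟨hu, norm_le_of_dotProduct_mulVec_self_le (by positivity) fun x => ?_⟩
  have h1 := hCS (W⁻¹ *ᵥ x)
  rw [Matrix.mulVec_mulVec, Matrix.mul_nonsing_inv W ((Matrix.isUnit_iff_isUnit_det W).1 hu),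
    Matrix.one_mulVec] at h1
  rw [inv_pow, inv_mul_eq_div, le_div_iff₀ (by positivity)]
  linarith

lemma mul_inv_of_isUnit {A : Matrix ι ι ℝ} (h : IsUnit A) : A * A⁻¹ = 1 :=
  Matrix.mul_nonsing_inv A ((Matrix.isUnit_iff_isUnit_det A).1 h)

lemma inv_mul_of_isUnit {A : Matrix ι ι ℝ} (h : IsUnit A) : A⁻¹ * A = 1 :=
  Matrix.nonsing_inv_mul A ((Matrix.isUnit_iff_isUnit_det A).1 h)

lemma _root_.ContinuousOn.matrix_inv {A : ℝ → Matrix ι ι ℝ} {s : Set ℝ}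
    (hA : ContinuousOn A s) (hu : ∀ t ∈ s, IsUnit (A t)) : ContinuousOn (fun t => (A t)⁻¹) s := by
  intro t ht
  have h : ContinuousAt (fun M : Matrix ι ι ℝ => M⁻¹) (A t) := by
    simp_rw [Matrix.nonsing_inv_eq_ringInverse]
    obtain ⟨u, hu⟩ := hu t ht
    rw [← hu]
    exact NormedRing.inverse_continuousAt u
  exact h.comp_continuousWithinAt (hA t ht)

lemma _root_.HasDerivAt.matrix_inv {A : ℝ → Matrix ι ι ℝ} {A' : Matrix ι ι ℝ} {t : ℝ}
    (hA : HasDerivAt A A' t) (hu : IsUnit (A t)) :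
    HasDerivAt (fun s => (A s)⁻¹) (-((A t)⁻¹ * A' * (A t)⁻¹)) t := by
  obtain ⟨u, hu⟩ := hu
  have h := hasFDerivAt_ringInverse (𝕜 := ℝ) u
  rw [hu] at h
  have h2 := h.comp_hasDerivAt t hA
  have h3 : (↑u⁻¹ : Matrix ι ι ℝ) = (A t)⁻¹ := by rw [← hu, Matrix.coe_units_inv]
  simp_rw [Matrix.nonsing_inv_eq_ringInverse] at h3 ⊢
  convert! h2 using 1
  simp [h3]

end Matrices

/-! ### Grönwall's inequality in integral form -/

lemma le_mul_exp_of_le_add_integral {u : ℝ → ℝ} {a b η M : ℝ} (hu : ContinuousOn u (Icc a b))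
    (hM : 0 ≤ M) (h : ∀ t ∈ Icc a b, u t ≤ η + M * ∫ s in a..t, u s) :
    ∀ t ∈ Icc a b, u t ≤ η * Real.exp (M * (t - a)) := by
  intro t ht
  have hab : a ≤ b := ht.1.trans ht.2
  -- Extend `u` continuously to `ℝ`, so that its primitive is differentiable everywhere.
  set v : ℝ → ℝ := IccExtend hab ((Icc a b).domRestrict u)
  have hv : Continuous v := (continuousOn_iff_continuous_domRestrict.1 hu).Icc_extend'
  have hvu : ∀ s ∈ Icc a b, v s = u s := fun s hs => by
    simp only [v, IccExtend_of_mem hab _ hs]; rfl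
  have hint : ∀ s ∈ Icc a b, ∫ r in a..s, u r = ∫ r in a..s, v r := fun s hs =>
    intervalIntegral.integral_congr fun r hr => by
      rw [uIcc_of_le hs.1] at hr
      exact (hvu r ⟨hr.1, hr.2.trans hs.2⟩).symm
  set F : ℝ → ℝ := fun s => η + M * ∫ r in a..s, v r
  have hF : ∀ s, HasDerivAt F (M * v s) s := fun s =>
    ((hv.integral_hasStrictDerivAt a s).hasDerivAt.const_mul M).const_add η
  have hle : ∀ s ∈ Icc a b, v s ≤ F s := fun s hs => by
    rw [hvu s hs]; simpa only [F, ← hint s hs] using h s hs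
  have hG := le_gronwallBound_of_liminf_deriv_right_le (f := F) (f' := fun s => M * v s) (δ := η)
    (K := M) (ε := 0) (a := a) (b := b) (fun s _ => (hF s).continuousAt.continuousWithinAt)
    (fun s _ r hr => (hF s).hasDerivWithinAt.liminf_right_slope_le hr) (by simp [F])
    (fun s hs => by
      have := hle s ⟨hs.1, hs.2.le⟩
      rw [add_zero]; gcongr) t ht
  rw [gronwallBound_ε0] at hG
  rw [← hvu t ht]
  exact (hle t ht).trans hG

/-- Grönwall's inequality for `D(t) = D(a) + ∫ f` with `‖f‖ ≤ M ‖D‖ + r`. The integrand `f` need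
not be measurable. -/
lemma norm_le_of_sub_eq_integral {E : Type*} [NormedAddCommGroup E] [NormedSpace ℝ E]
    {D f : ℝ → E} {r : ℝ → ℝ} {a b M : ℝ} (hM : 0 ≤ M) (hD : ContinuousOn D (Icc a b))
    (hr : ContinuousOn r (Icc a b)) (hr0 : ∀ s ∈ Icc a b, 0 ≤ r s)
    (hf : ∀ t ∈ Icc a b, D t - D a = ∫ s in a..t, f s)
    (hb : ∀ s ∈ Icc a b, ‖f s‖ ≤ M * ‖D s‖ + r s) :
    ∀ t ∈ Icc a b, ‖D t‖ ≤ (‖D a‖ + ∫ s in a..b, r s) * Real.exp (M * (t - a)) := by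
  refine le_mul_exp_of_le_add_integral hD.norm hM fun t ht => ?_
  have hsub : Icc a t ⊆ Icc a b := Icc_subset_Icc le_rfl ht.2
  have hab : a ≤ b := ht.1.trans ht.2
  have hDi : IntervalIntegrable (fun s => ‖D s‖) volume a t :=
    (hD.norm.mono hsub).intervalIntegrable_of_Icc ht.1
  have hri : IntervalIntegrable r volume a t := (hr.mono hsub).intervalIntegrable_of_Icc ht.1
  have h1 : ‖∫ s in a..t, f s‖ ≤ ∫ s in a..t, (M * ‖D s‖ + r s) :=
    intervalIntegral.norm_integral_le_of_norm_le ht.1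
      (Filter.Eventually.of_forall fun s hs => hb s (hsub ⟨hs.1.le, hs.2⟩))
      ((hDi.const_mul M).add hri)
  rw [intervalIntegral.integral_add (hDi.const_mul M) hri, intervalIntegral.integral_const_mul] at h1
  have h2 : ∫ s in a..t, r s ≤ ∫ s in a..b, r s :=
    intervalIntegral.integral_mono_interval le_rfl ht.1 ht.2
      ((ae_restrict_iff' measurableSet_Ioc).2 (Filter.Eventually.of_forall fun s hs =>
        hr0 s ⟨hs.1.le, hs.2⟩)) (hr.intervalIntegrable_of_Icc hab)
  have h3 : ‖D t‖ ≤ ‖D a‖ + ‖∫ s in a..t, f s‖ := by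
    rw [← hf t ht]
    simpa using norm_add_le (D a) (D t - D a)
  linarith

/-! ### Fundamental matrices -/

section Fundamental

variable {ι κ ο : Type*} [Fintype ι] [DecidableEq ι] [Fintype κ] [DecidableEq κ]
  [Fintype ο] [DecidableEq ο]

lemma _root_.UniformlyBounded.exists_nonneg {M : ℝ → Matrix ι κ ℝ} (h : UniformlyBounded M) :
    ∃ c : ℝ, 0 ≤ c ∧ ∀ t, 0 ≤ t → ‖M t‖ ≤ c := by
  obtain ⟨c, hc⟩ := h
  exact ⟨c, (norm_nonneg _).trans (hc 0 le_rfl), hc⟩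

variable {A X Y : ℝ → Matrix ι ι ℝ}

lemma _root_.IsFundamentalMatrix.isUnit (h : IsFundamentalMatrix A X) {t : ℝ} (ht : 0 ≤ t) :
    IsUnit (X t) := h.2.1 t ht

lemma _root_.IsFundamentalMatrix.intervalIntegrable (h : IsFundamentalMatrix A X) {a b : ℝ}
    (ha : 0 ≤ a) (hb : 0 ≤ b) : IntervalIntegrable (fun s => A s * X s) volume a b :=
  (h.2.2.1 a ha).symm.trans (h.2.2.1 b hb)

lemma _root_.IsFundamentalMatrix.sub_eq_integral (h : IsFundamentalMatrix A X) {a b : ℝ}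
    (ha : 0 ≤ a) (hb : 0 ≤ b) : X b - X a = ∫ s in a..b, A s * X s := by
  rw [h.2.2.2 b hb, h.2.2.2 a ha, add_sub_add_left_eq_sub,
    intervalIntegral.integral_interval_sub_left (h.2.2.1 b hb) (h.2.2.1 a ha)]

lemma _root_.IsFundamentalMatrix.sub_mul_eq_integral (h : IsFundamentalMatrix A X) {a b : ℝ}
    (ha : 0 ≤ a) (hb : 0 ≤ b) (G : Matrix ι κ ℝ) :
    X b * G - X a * G = ∫ s in a..b, A s * (X s * G) := by
  simp_rw [← Matrix.mul_assoc]
  rw [integral_matrix_mul_const G (h.intervalIntegrable ha hb), ← h.sub_eq_integral ha hb,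
    Matrix.sub_mul]

lemma Ici_subset_of_nonneg {a b : ℝ} (ha : 0 ≤ a) : Icc a b ⊆ Ici 0 := fun _ hs => ha.trans hs.1

lemma continuousAt_of_continuousOn_Ici {E : Type*} [TopologicalSpace E] {f : ℝ → E}
    (hf : ContinuousOn f (Ici 0)) {t : ℝ} (ht : 0 < t) : ContinuousAt f t :=
  hf.continuousAt (Ici_mem_nhds ht)

lemma intervalIntegrable_of_continuousOn_Ici {E : Type*} [NormedAddCommGroup E] {f : ℝ → E}
    (hf : ContinuousOn f (Ici 0)) {a b : ℝ} (ha : 0 ≤ a) (hb : 0 ≤ b) :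
    IntervalIntegrable f volume a b :=
  (hf.mono fun _ hs => (le_min ha hb).trans hs.1).intervalIntegrable

lemma hasDerivAt_integral_of_continuousOn_Ici {E : Type*} [NormedAddCommGroup E]
    [NormedSpace ℝ E] [CompleteSpace E] {f : ℝ → E} (hf : ContinuousOn f (Ici 0)) {t : ℝ}
    (ht : 0 < t) : HasDerivAt (fun s => ∫ r in (0 : ℝ)..s, f r) (f t) t :=
  intervalIntegral.integral_hasDerivAt_right
    (intervalIntegrable_of_continuousOn_Ici hf le_rfl ht.le)
    ((hf.mono Ioi_subset_Ici_self).stronglyMeasurableAtFilter isOpen_Ioi t ht)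
    (continuousAt_of_continuousOn_Ici hf ht)

lemma continuousOn_integral_of_continuousOn_Ici {E : Type*} [NormedAddCommGroup E]
    [NormedSpace ℝ E] [CompleteSpace E] {f : ℝ → E} (hf : ContinuousOn f (Ici 0)) :
    ContinuousOn (fun s => ∫ r in (0 : ℝ)..s, f r) (Ici 0) := by
  intro t ht
  have h0 : (0 : ℝ) ≤ t + 1 := add_nonneg ht zero_le_one
  have h := intervalIntegral.continuousOn_primitive_interval'
    (intervalIntegrable_of_continuousOn_Ici hf le_rfl h0) left_mem_uIcc
  rw [uIcc_of_le h0] at h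
  refine (h t ⟨ht, by linarith⟩).mono_of_mem_nhdsWithin ?_
  rw [← Ici_inter_Iic]
  exact Filter.inter_mem self_mem_nhdsWithin (mem_nhdsWithin_of_mem_nhds (Iic_mem_nhds (by linarith)))

/-- For continuous `A`, a fundamental matrix is a classical solution in the interior of the time
interval. -/
lemma _root_.IsFundamentalMatrix.hasDerivAt (h : IsFundamentalMatrix A X)
    (hA : ContinuousOn A (Ici 0)) {t : ℝ} (ht : 0 < t) : HasDerivAt X (A t * X t) t := by
  have h1 := (hasDerivAt_integral_of_continuousOn_Ici (hA.matrix_mul h.1) ht).const_add (X 0)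
  refine h1.congr_of_eventuallyEq ?_
  filter_upwards [Ici_mem_nhds ht] with s hs using h.2.2.2 s hs

/-- A classical solution in the interior that is continuous up to time `0` is a fundamental
matrix. -/
lemma isFundamentalMatrix_of_hasDerivAt (hA : ContinuousOn A (Ici 0))
    (hX : ContinuousOn X (Ici 0)) (hu : ∀ t, 0 ≤ t → IsUnit (X t))
    (hd : ∀ t, 0 < t → HasDerivAt X (A t * X t) t) : IsFundamentalMatrix A X := by
  have hi : ∀ t : ℝ, 0 ≤ t → IntervalIntegrable (fun s => A s * X s) volume 0 t := fun t ht =>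
    intervalIntegrable_of_continuousOn_Ici (hA.matrix_mul hX) le_rfl ht
  refine ⟨hX, hu, hi, fun t ht => ?_⟩
  rw [intervalIntegral.integral_eq_sub_of_hasDeriv_right_of_le ht
    (hX.mono (Ici_subset_of_nonneg le_rfl)) (fun s hs => (hd s hs.1).hasDerivWithinAt) (hi t ht)]
  abel

/-- Uniformly bounded coefficients bound the growth of the transition matrix. -/
lemma norm_transitionMatrix_le (h : IsFundamentalMatrix A X) {M : ℝ} (hM : 0 ≤ M)
    (hA : ∀ t, 0 ≤ t → ‖A t‖ ≤ M) {t₀ t : ℝ} (h₀ : 0 ≤ t₀) (ht : t₀ ≤ t) :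
    ‖transitionMatrix X t t₀‖ ≤ Real.exp (M * (t - t₀)) := by
  have h1 := norm_le_of_sub_eq_integral (D := fun s => transitionMatrix X s t₀) (r := fun _ => 0)
    (a := t₀) (b := t) hM
    ((h.1.matrix_mul continuousOn_const).mono (Ici_subset_of_nonneg h₀)) continuousOn_const
    (fun _ _ => le_rfl) (fun s hs => h.sub_mul_eq_integral h₀ (h₀.trans hs.1) _)
    (fun s hs => by
      rw [add_zero]
      refine (Matrix.l2_opNorm_mul _ _).trans ?_
      exact mul_le_mul_of_nonneg_right (hA s (h₀.trans hs.1)) (norm_nonneg _)) t ⟨ht, le_rfl⟩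
  refine h1.trans ?_
  simp only [intervalIntegral.integral_zero, add_zero]
  have : ‖transitionMatrix X t₀ t₀‖ ≤ 1 := by
    rw [transitionMatrix, mul_inv_of_isUnit (h.isUnit h₀)]
    exact norm_one_le
  exact mul_le_of_le_one_left (Real.exp_nonneg _) this

/-- Fundamental matrices are unique up to a constant factor on the right, so that the transition
matrix does not depend on the choice. -/
lemma transitionMatrix_unique (hX : IsFundamentalMatrix A X) (hY : IsFundamentalMatrix A Y)
    (hA : UniformlyBounded A) {s t : ℝ} (hs : 0 ≤ s) (ht : 0 ≤ t) :
    transitionMatrix X t s = transitionMatrix Y t s := by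
  obtain ⟨M, hM, hAM⟩ := hA.exists_nonneg
  have key : ∀ r, 0 ≤ r → Y r = X r * ((X 0)⁻¹ * Y 0) := by
    intro r hr
    have h1 := norm_le_of_sub_eq_integral
      (D := fun s => Y s - X s * ((X 0)⁻¹ * Y 0)) (r := fun _ => 0)
      (f := fun s => A s * Y s - A s * (X s * ((X 0)⁻¹ * Y 0)))
      (a := 0) (b := r) hM
      ((hY.1.sub (hX.1.matrix_mul continuousOn_const)).mono (Ici_subset_of_nonneg le_rfl))
      continuousOn_const (fun _ _ => le_rfl)
      (fun s hs => by
        rw [intervalIntegral.integral_sub (hY.intervalIntegrable le_rfl hs.1), ←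
          hY.sub_eq_integral le_rfl hs.1, ← hX.sub_mul_eq_integral le_rfl hs.1]
        · abel
        · simp_rw [← Matrix.mul_assoc]
          simpa only [Matrix.mul_assoc] using
            (hX.intervalIntegrable le_rfl hs.1).matrix_mul_const ((X 0)⁻¹ * Y 0))
      (fun s hs => by
        rw [add_zero, ← Matrix.mul_sub]
        refine (Matrix.l2_opNorm_mul _ _).trans ?_
        gcongr
        exact hAM s hs.1) r ⟨hr, le_rfl⟩
    rw [← Matrix.mul_assoc (X 0), mul_inv_of_isUnit (hX.isUnit le_rfl), Matrix.one_mul,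
      sub_self, norm_zero, intervalIntegral.integral_zero, add_zero, zero_mul] at h1
    exact sub_eq_zero.1 (norm_le_zero_iff.1 h1)
  have hG : IsUnit ((X 0)⁻¹ * Y 0) := by
    refine IsUnit.mul ?_ (hY.isUnit le_rfl)
    exact Matrix.isUnit_nonsing_inv_iff.2 (hX.isUnit le_rfl)
  rw [transitionMatrix, transitionMatrix, key t ht, key s hs, Matrix.mul_inv_rev,
    Matrix.mul_assoc, ← Matrix.mul_assoc _ _ (X s)⁻¹, mul_inv_of_isUnit hG, Matrix.one_mul]

lemma transitionMatrix_mul (h : IsFundamentalMatrix A X) {r s t : ℝ} (hs : 0 ≤ s) :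
    transitionMatrix X t s * transitionMatrix X s r = transitionMatrix X t r := by
  rw [transitionMatrix, transitionMatrix, transitionMatrix, Matrix.mul_assoc,
    ← Matrix.mul_assoc (X s)⁻¹, inv_mul_of_isUnit (h.isUnit hs), Matrix.one_mul]

lemma transitionMatrix_self (h : IsFundamentalMatrix A X) {t : ℝ} (ht : 0 ≤ t) :
    transitionMatrix X t t = 1 := mul_inv_of_isUnit (h.isUnit ht)

end Fundamental

/-! ### Block matrices -/

section Blocks

variable {α β ρ ν : Type*} [Fintype α] [DecidableEq α] [Fintype β] [DecidableEq β]
  [Fintype ρ] [DecidableEq ρ] [Fintype ν] [DecidableEq ν]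

/-- The embedding of the first block of coordinates. -/
def inlMat (α β : Type*) [DecidableEq α] : Matrix (α ⊕ β) α ℝ := Matrix.fromRows 1 0

/-- The embedding of the second block of coordinates. -/
def inrMat (α β : Type*) [DecidableEq β] : Matrix (α ⊕ β) β ℝ := Matrix.fromRows 0 1

lemma inlMat_transpose_mul_self : (inlMat α β)ᵀ * inlMat α β = 1 := by
  simp [inlMat, Matrix.transpose_fromRows, Matrix.fromCols_mul_fromRows]

lemma inrMat_transpose_mul_self : (inrMat α β)ᵀ * inrMat α β = 1 := by
  simp [inrMat, Matrix.transpose_fromRows, Matrix.fromCols_mul_fromRows]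

lemma norm_le_one_of_transpose_mul_self {E : Matrix ν ρ ℝ} (h : Eᵀ * E = 1) : ‖E‖ ≤ 1 := by
  have h1 := Matrix.l2_opNorm_conjTranspose_mul_self E
  rw [Matrix.conjTranspose_eq_transpose_of_trivial, h] at h1
  have h2 := norm_one_le (ι := ρ)
  nlinarith [norm_nonneg E]

lemma norm_inlMat_le : ‖inlMat α β‖ ≤ 1 :=
  norm_le_one_of_transpose_mul_self inlMat_transpose_mul_self

lemma norm_inrMat_le : ‖inrMat α β‖ ≤ 1 :=
  norm_le_one_of_transpose_mul_self inrMat_transpose_mul_self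

lemma norm_mul_mul_le_of_le_one {P : Matrix α β ℝ} {Q : Matrix ρ ν ℝ} (hP : ‖P‖ ≤ 1)
    (hQ : ‖Q‖ ≤ 1) (M : Matrix β ρ ℝ) : ‖P * M * Q‖ ≤ ‖M‖ := by
  calc ‖P * M * Q‖ ≤ ‖P * M‖ * ‖Q‖ := Matrix.l2_opNorm_mul _ _
    _ ≤ ‖P‖ * ‖M‖ * ‖Q‖ := by gcongr; exact Matrix.l2_opNorm_mul _ _
    _ ≤ 1 * ‖M‖ * 1 := by gcongr
    _ = ‖M‖ := by ring

lemma toBlocks₁₁_eq (M : Matrix (α ⊕ β) (α ⊕ β) ℝ) :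
    M.toBlocks₁₁ = (inlMat α β)ᵀ * M * inlMat α β := by
  conv_rhs => rw [← Matrix.fromBlocks_toBlocks M]
  simp [inlMat, Matrix.transpose_fromRows, Matrix.fromCols_mul_fromBlocks,
    Matrix.fromCols_mul_fromRows]

lemma toBlocks₂₂_eq (M : Matrix (α ⊕ β) (α ⊕ β) ℝ) :
    M.toBlocks₂₂ = (inrMat α β)ᵀ * M * inrMat α β := by
  conv_rhs => rw [← Matrix.fromBlocks_toBlocks M]
  simp [inrMat, Matrix.transpose_fromRows, Matrix.fromCols_mul_fromBlocks,
    Matrix.fromCols_mul_fromRows]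

lemma norm_toBlocks₁₁_le (M : Matrix (α ⊕ β) (α ⊕ β) ℝ) : ‖M.toBlocks₁₁‖ ≤ ‖M‖ := by
  rw [toBlocks₁₁_eq]
  exact norm_mul_mul_le_of_le_one (norm_transpose (inlMat α β) ▸ norm_inlMat_le) norm_inlMat_le _

lemma norm_toBlocks₂₂_le (M : Matrix (α ⊕ β) (α ⊕ β) ℝ) : ‖M.toBlocks₂₂‖ ≤ ‖M‖ := by
  rw [toBlocks₂₂_eq]
  exact norm_mul_mul_le_of_le_one (norm_transpose (inrMat α β) ▸ norm_inrMat_le) norm_inrMat_le _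

lemma fromBlocks_zero₂₁_eq (A : Matrix α α ℝ) (B : Matrix α β ℝ) (D : Matrix β β ℝ) :
    Matrix.fromBlocks A B 0 D = inlMat α β * A * (inlMat α β)ᵀ + inlMat α β * B * (inrMat α β)ᵀ
      + inrMat α β * D * (inrMat α β)ᵀ := by
  ext (i | i) (j | j) <;> simp [inlMat, inrMat, Matrix.transpose_fromRows, Matrix.fromRows_mul]

lemma norm_fromBlocks_zero₂₁_le (A : Matrix α α ℝ) (B : Matrix α β ℝ) (D : Matrix β β ℝ) :
    ‖Matrix.fromBlocks A B 0 D‖ ≤ ‖A‖ + ‖B‖ + ‖D‖ := by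
  rw [fromBlocks_zero₂₁_eq]
  have hl := norm_inlMat_le (α := α) (β := β)
  have hr := norm_inrMat_le (α := α) (β := β)
  have hl' := hl; have hr' := hr
  rw [← norm_transpose] at hl' hr'
  refine (norm_add_le _ _).trans (add_le_add ((norm_add_le _ _).trans (add_le_add ?_ ?_)) ?_) <;>
  exact norm_mul_mul_le_of_le_one (by assumption) (by assumption) _

lemma norm_fromCols_le (C₁ : Matrix ρ α ℝ) (C₂ : Matrix ρ β ℝ) :
    ‖Matrix.fromCols C₁ C₂‖ ≤ ‖C₁‖ + ‖C₂‖ := by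
  have h : Matrix.fromCols C₁ C₂ =
      (1 : Matrix ρ ρ ℝ) * C₁ * (inlMat α β)ᵀ + (1 : Matrix ρ ρ ℝ) * C₂ * (inrMat α β)ᵀ := by
    ext i (j | j) <;> simp [inlMat, inrMat, Matrix.transpose_fromRows, Matrix.mul_fromCols]
  have hl := norm_inlMat_le (α := α) (β := β)
  have hr := norm_inrMat_le (α := α) (β := β)
  rw [← norm_transpose] at hl hr
  rw [h]
  exact (norm_add_le _ _).trans (add_le_add (norm_mul_mul_le_of_le_one norm_one_le hl _)
    (norm_mul_mul_le_of_le_one norm_one_le hr _))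

lemma norm_fromRows_zero_le (L : Matrix α ρ ℝ) :
    ‖Matrix.fromRows L (0 : Matrix β ρ ℝ)‖ ≤ ‖L‖ := by
  have h : Matrix.fromRows L (0 : Matrix β ρ ℝ) = inlMat α β * L * (1 : Matrix ρ ρ ℝ) := by
    simp [inlMat, Matrix.fromRows_mul]
  rw [h]
  exact norm_mul_mul_le_of_le_one norm_inlMat_le norm_one_le _

lemma norm_inlMat_mul (M : Matrix α ρ ℝ) : ‖inlMat α β * M‖ = ‖M‖ := by
  apply le_antisymm
  · simpa using norm_mul_mul_le_of_le_one (norm_inlMat_le (α := α) (β := β))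
      (norm_one_le (ι := ρ)) M
  · have h : M = (inlMat α β)ᵀ * (inlMat α β * M) * (1 : Matrix ρ ρ ℝ) := by
      rw [← Matrix.mul_assoc, inlMat_transpose_mul_self, Matrix.one_mul, Matrix.mul_one]
    conv_lhs => rw [h]
    exact norm_mul_mul_le_of_le_one (norm_transpose (inlMat α β) ▸ norm_inlMat_le) norm_one_le _

lemma continuousOn_fromBlocks_zero₂₁ {A : ℝ → Matrix α α ℝ} {B : ℝ → Matrix α β ℝ}
    {D : ℝ → Matrix β β ℝ} {s : Set ℝ} (hA : ContinuousOn A s) (hB : ContinuousOn B s)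
    (hD : ContinuousOn D s) :
    ContinuousOn (fun t => Matrix.fromBlocks (A t) (B t) 0 (D t)) s := by
  simp_rw [fromBlocks_zero₂₁_eq]
  exact (((continuousOn_const.matrix_mul hA).matrix_mul continuousOn_const).add
    ((continuousOn_const.matrix_mul hB).matrix_mul continuousOn_const)).add
    ((continuousOn_const.matrix_mul hD).matrix_mul continuousOn_const)

lemma hasDerivAt_fromBlocks_zero₂₁ {A : ℝ → Matrix α α ℝ} {B : ℝ → Matrix α β ℝ}
    {D : ℝ → Matrix β β ℝ} {A' : Matrix α α ℝ} {B' : Matrix α β ℝ} {D' : Matrix β β ℝ} {t : ℝ}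
    (hA : HasDerivAt A A' t) (hB : HasDerivAt B B' t) (hD : HasDerivAt D D' t) :
    HasDerivAt (fun t => Matrix.fromBlocks (A t) (B t) 0 (D t)) (Matrix.fromBlocks A' B' 0 D') t := by
  simp_rw [fromBlocks_zero₂₁_eq]
  exact (((mulMulCLM (inlMat α β) (inlMat α β)ᵀ).hasFDerivAt.comp_hasDerivAt t hA).add
    ((mulMulCLM (inlMat α β) (inrMat α β)ᵀ).hasFDerivAt.comp_hasDerivAt t hB)).add
    ((mulMulCLM (inrMat α β) (inrMat α β)ᵀ).hasFDerivAt.comp_hasDerivAt t hD)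

/-! ### Block triangular fundamental matrices -/

lemma isUnit_blocks {M : Matrix (α ⊕ β) (α ⊕ β) ℝ} (h : IsUnit M) (h0 : M.toBlocks₂₁ = 0) :
    IsUnit M.toBlocks₁₁ ∧ IsUnit M.toBlocks₂₂ := by
  rw [← Matrix.fromBlocks_toBlocks M, h0] at h
  exact Matrix.isUnit_fromBlocks_zero₂₁.1 h

lemma inv_eq_fromBlocks {M : Matrix (α ⊕ β) (α ⊕ β) ℝ} (h : IsUnit M) (h0 : M.toBlocks₂₁ = 0) :
    M⁻¹ = Matrix.fromBlocks M.toBlocks₁₁⁻¹ (-(M.toBlocks₁₁⁻¹ * M.toBlocks₁₂ * M.toBlocks₂₂⁻¹)) 0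
      M.toBlocks₂₂⁻¹ := by
  have hu := isUnit_blocks h h0
  conv_lhs => rw [← Matrix.fromBlocks_toBlocks M, h0]
  exact Matrix.inv_fromBlocks_zero₂₁_of_isUnit_iff _ _ _ (iff_of_true hu.1 hu.2)

variable {B₁₁ : ℝ → Matrix α α ℝ} {B₁₂ : ℝ → Matrix α β ℝ} {B₂₂ : ℝ → Matrix β β ℝ}
  {X : ℝ → Matrix (α ⊕ β) (α ⊕ β) ℝ}

/-- A compression `M ↦ Eᵀ M E` that intertwines the coefficient matrices maps solutions to solutions.
With `E` a block embedding, this gives the fundamental matrices of the diagonal blocks. -/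
lemma isFundamentalMatrix_compress {A : ℝ → Matrix ν ν ℝ} {Z : ℝ → Matrix ν ν ℝ}
    {A' : ℝ → Matrix ρ ρ ℝ} (E : Matrix ν ρ ℝ) (h : IsFundamentalMatrix A Z)
    (hu : ∀ t, 0 ≤ t → IsUnit (Eᵀ * Z t * E))
    (hE : ∀ t, 0 ≤ t → Eᵀ * (A t * Z t) * E = A' t * (Eᵀ * Z t * E)) :
    IsFundamentalMatrix A' fun t => Eᵀ * Z t * E := by
  have hcongr : ∀ t, 0 ≤ t → EqOn (fun s => Eᵀ * (A s * Z s) * E)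
      (fun s => A' s * (Eᵀ * Z s * E)) (uIcc 0 t) := fun t ht s hs => by
    rw [uIcc_of_le ht] at hs
    exact hE s hs.1
  refine ⟨(continuousOn_const.matrix_mul h.1).matrix_mul continuousOn_const, hu, fun t ht => ?_,
    fun t ht => ?_⟩
  · exact ((h.2.2.1 t ht).mul_mul Eᵀ E).congr
      (fun s hs => hcongr t ht (uIoc_subset_uIcc hs))
  · beta_reduce
    rw [← intervalIntegral.integral_congr (hcongr t ht), integral_mul_mul _ _ (h.2.2.1 t ht)]
    conv_lhs => rw [h.2.2.2 t ht]
    rw [Matrix.mul_add, Matrix.add_mul]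

lemma isFundamentalMatrix_toBlocks₁₁
    (h : IsFundamentalMatrix (fun t => Matrix.fromBlocks (B₁₁ t) (B₁₂ t) 0 (B₂₂ t)) X)
    (h0 : ∀ t, 0 ≤ t → (X t).toBlocks₂₁ = 0) :
    IsFundamentalMatrix B₁₁ fun t => (X t).toBlocks₁₁ := by
  simp_rw [toBlocks₁₁_eq]
  refine isFundamentalMatrix_compress (inlMat α β) h (fun t ht => ?_) fun t ht => ?_
  · rw [← toBlocks₁₁_eq]
    exact (isUnit_blocks (h.isUnit ht) (h0 t ht)).1
  · rw [← toBlocks₁₁_eq, ← toBlocks₁₁_eq]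
    conv_lhs => rw [← Matrix.fromBlocks_toBlocks (X t), h0 t ht, Matrix.fromBlocks_multiply]
    simp

lemma isFundamentalMatrix_toBlocks₂₂
    (h : IsFundamentalMatrix (fun t => Matrix.fromBlocks (B₁₁ t) (B₁₂ t) 0 (B₂₂ t)) X)
    (h0 : ∀ t, 0 ≤ t → (X t).toBlocks₂₁ = 0) :
    IsFundamentalMatrix B₂₂ fun t => (X t).toBlocks₂₂ := by
  simp_rw [toBlocks₂₂_eq]
  refine isFundamentalMatrix_compress (inrMat α β) h (fun t ht => ?_) fun t ht => ?_
  · rw [← toBlocks₂₂_eq]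
    exact (isUnit_blocks (h.isUnit ht) (h0 t ht)).2
  · rw [← toBlocks₂₂_eq, ← toBlocks₂₂_eq]
    conv_lhs => rw [← Matrix.fromBlocks_toBlocks (X t), h0 t ht, Matrix.fromBlocks_multiply]
    simp

lemma transitionMatrix_mul_inlMat {s t : ℝ} (hu : IsUnit (X s)) (hs : (X s).toBlocks₂₁ = 0)
    (ht : (X t).toBlocks₂₁ = 0) :
    transitionMatrix X t s * inlMat α β =
      inlMat α β * transitionMatrix (fun r => (X r).toBlocks₁₁) t s := by
  rw [transitionMatrix, inv_eq_fromBlocks hu hs]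
  conv_lhs => rw [← Matrix.fromBlocks_toBlocks (X t), ht]
  simp [Matrix.fromBlocks_multiply, inlMat, Matrix.fromBlocks_mul_fromRows, transitionMatrix,
    Matrix.fromRows_mul]

/-- In a dichotomy with projection onto the second block of coordinates, the second diagonal block
is exponentially stable. -/
lemma norm_transitionMatrix_toBlocks₂₂_le {s t : ℝ} (hu : IsUnit (X s))
    (hs : (X s).toBlocks₂₁ = 0) (ht : (X t).toBlocks₂₁ = 0) :
    ‖transitionMatrix (fun r => (X r).toBlocks₂₂) t s‖ ≤
      ‖X t * Matrix.fromBlocks 0 0 0 1 * (X s)⁻¹‖ := by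
  refine le_trans (le_of_eq ?_) (norm_toBlocks₂₂_le _)
  rw [inv_eq_fromBlocks hu hs]
  conv_rhs => rw [← Matrix.fromBlocks_toBlocks (X t), ht]
  simp [Matrix.fromBlocks_multiply, transitionMatrix]

/-- In a dichotomy with projection onto the second block of coordinates, the first diagonal block
is exponentially stable backward in time. -/
lemma norm_transitionMatrix_toBlocks₁₁_le {s t : ℝ} (hu : IsUnit (X s))
    (hs : (X s).toBlocks₂₁ = 0) (ht : (X t).toBlocks₂₁ = 0) :
    ‖transitionMatrix (fun r => (X r).toBlocks₁₁) t s‖ ≤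
      ‖X t * (1 - Matrix.fromBlocks 0 0 0 1) * (X s)⁻¹‖ := by
  refine le_trans (le_of_eq ?_) (norm_toBlocks₁₁_le _)
  rw [inv_eq_fromBlocks hu hs]
  conv_rhs => rw [← Matrix.fromBlocks_toBlocks (X t), ht]
  have h1 : (1 : Matrix (α ⊕ β) (α ⊕ β) ℝ) - Matrix.fromBlocks 0 0 0 1 =
      Matrix.fromBlocks 1 0 0 0 := by
    rw [sub_eq_iff_eq_add, Matrix.fromBlocks_add]
    simp
  simp [h1, Matrix.fromBlocks_multiply, transitionMatrix]

end Blocks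

section Observability

variable {ι κ ο : Type*} [Fintype ι] [DecidableEq ι] [Fintype κ] [DecidableEq κ]
  [Fintype ο] [DecidableEq ο]

variable {A X : ℝ → Matrix ι ι ℝ} {C : ℝ → Matrix ο ι ℝ}

/-! ### The observability Gramian -/

lemma gramian_integrand_eq (X : ℝ → Matrix ι ι ℝ) (C : ℝ → Matrix ο ι ℝ) (s t₀ : ℝ) :
    (transitionMatrix X s t₀)ᵀ * (C s)ᵀ * C s * transitionMatrix X s t₀ =
      (C s * transitionMatrix X s t₀)ᵀ * (C s * transitionMatrix X s t₀) := by
  rw [Matrix.transpose_mul]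
  simp only [Matrix.mul_assoc]

lemma continuousOn_gramian_integrand (h : IsFundamentalMatrix A X) (hC : ContinuousOn C (Ici 0))
    (t₀ : ℝ) : ContinuousOn (fun s => (C s * transitionMatrix X s t₀)ᵀ *
      (C s * transitionMatrix X s t₀)) (Ici 0) := by
  have h1 : ContinuousOn (fun s => C s * transitionMatrix X s t₀) (Ici 0) :=
    hC.matrix_mul (h.1.matrix_mul continuousOn_const)
  exact h1.matrix_transpose.matrix_mul h1

lemma observabilityGramian_isHermitian (h : IsFundamentalMatrix A X)
    (hC : ContinuousOn C (Ici 0)) {t₀ t₁ : ℝ} (h₀ : 0 ≤ t₀) (h₁ : 0 ≤ t₁) :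
    (observabilityGramian X C t₁ t₀).IsHermitian := by
  simp_rw [observabilityGramian, gramian_integrand_eq]
  exact integral_isHermitian
    (intervalIntegrable_of_continuousOn_Ici (continuousOn_gramian_integrand h hC t₀) h₀ h₁)
    fun s => by rw [Matrix.transpose_mul, Matrix.transpose_transpose]

/-- The quadratic form of the observability Gramian is the output energy. -/
lemma dotProduct_observabilityGramian (h : IsFundamentalMatrix A X)
    (hC : ContinuousOn C (Ici 0)) {t₀ t₁ : ℝ} (h₀ : 0 ≤ t₀) (h₁ : 0 ≤ t₁) (x : ι → ℝ) :
    x ⬝ᵥ observabilityGramian X C t₁ t₀ *ᵥ x =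
      ∫ s in t₀..t₁, ‖C s * (transitionMatrix X s t₀ * Matrix.replicateCol Unit x)‖ ^ 2 := by
  simp_rw [observabilityGramian, gramian_integrand_eq]
  rw [dotProduct_integral_mulVec
    (intervalIntegrable_of_continuousOn_Ici (continuousOn_gramian_integrand h hC t₀) h₀ h₁)]
  congr 1 with s
  rw [dotProduct_transpose_mul_self, ← Matrix.mul_assoc, ← Matrix.replicateCol_mulVec,
    norm_replicateCol_sq]

lemma posSemidef_sub_smul_one_iff {G : Matrix ι ι ℝ} (hG : G.IsHermitian) (β : ℝ) :
    (G - β • (1 : Matrix ι ι ℝ)).PosSemidef ↔ ∀ x, β * (x ⬝ᵥ x) ≤ x ⬝ᵥ G *ᵥ x := by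
  rw [Matrix.posSemidef_iff_dotProduct_mulVec, and_iff_right]
  · simp [Matrix.sub_mulVec, dotProduct_sub, Matrix.smul_mulVec]
  · exact Matrix.IsHermitian.sub hG (by simp [Matrix.IsHermitian])

lemma posSemidef_smul_one_sub_iff {G : Matrix ι ι ℝ} (hG : G.IsHermitian) (β : ℝ) :
    (β • (1 : Matrix ι ι ℝ) - G).PosSemidef ↔ ∀ x, x ⬝ᵥ G *ᵥ x ≤ β * (x ⬝ᵥ x) := by
  rw [Matrix.posSemidef_iff_dotProduct_mulVec, and_iff_right]
  · simp [Matrix.sub_mulVec, dotProduct_sub, Matrix.smul_mulVec]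
  · exact Matrix.IsHermitian.sub (by simp [Matrix.IsHermitian]) hG

/-- Cauchy–Schwarz against a constant: a lower bound on `∫ f` gives one on `∫ f²`. -/
lemma sq_div_le_integral_sq {f : ℝ → ℝ} {a b c : ℝ} (hab : a < b) (hf : ContinuousOn f (Icc a b))
    (hc : 0 ≤ c) (h : c ≤ ∫ s in a..b, f s) : c ^ 2 / (b - a) ≤ ∫ s in a..b, f s ^ 2 := by
  have hba : 0 < b - a := sub_pos.2 hab
  set δ := c / (b - a)
  have hδ : 0 ≤ δ := by positivity
  have hfi : IntervalIntegrable f volume a b := hf.intervalIntegrable_of_Icc hab.le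
  have h1 : ∫ s in a..b, (2 * δ * f s - δ ^ 2) ≤ ∫ s in a..b, f s ^ 2 :=
    intervalIntegral.integral_mono_on hab.le
      ((hfi.const_mul _).sub intervalIntegrable_const)
      ((hf.pow 2).intervalIntegrable_of_Icc hab.le) fun s _ => by nlinarith [sq_nonneg (f s - δ)]
  rw [intervalIntegral.integral_sub (hfi.const_mul _) intervalIntegrable_const,
    intervalIntegral.integral_const_mul, intervalIntegral.integral_const, smul_eq_mul] at h1
  have h2 : 2 * δ * c ≤ 2 * δ * ∫ s in a..b, f s := by gcongr
  have h3 : c ^ 2 / (b - a) = 2 * δ * c - (b - a) * δ ^ 2 := by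
    simp only [δ]; field_simp; ring
  linarith

/-! ### Detectability forces observability of the antistable block -/

/-- Output injection changes a trajectory only through its output: over a bounded time interval,
trajectories of `x' = A x` and of the observer error system `e' = (A - L C) e` with the same
initial value differ by at most a constant times the integral of the norm of the output of the
former. -/
lemma norm_sub_le_integral_output {L : ℝ → Matrix ι ο ℝ} {Xe : ℝ → Matrix ι ι ℝ}
    (hX : IsFundamentalMatrix A X) (hXe : IsFundamentalMatrix (fun t => A t - L t * C t) Xe)
    (hC : ContinuousOn C (Ici 0)) {M ℓ : ℝ} (hM : 0 ≤ M) (hℓ : 0 ≤ ℓ)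
    (hAM : ∀ t, 0 ≤ t → ‖A t - L t * C t‖ ≤ M) (hLℓ : ∀ t, 0 ≤ t → ‖L t‖ ≤ ℓ)
    {t₀ t : ℝ} (h₀ : 0 ≤ t₀) (ht : t₀ ≤ t) (V : Matrix ι κ ℝ) :
    ‖transitionMatrix X t t₀ * V - transitionMatrix Xe t t₀ * V‖ ≤
      (ℓ * ∫ s in t₀..t, ‖C s * (transitionMatrix X s t₀ * V)‖) * Real.exp (M * (t - t₀)) := by
  have hsub := Ici_subset_of_nonneg (b := t) h₀
  have cX : ContinuousOn (fun s => transitionMatrix X s t₀ * V) (Icc t₀ t) :=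
    ((hX.1.matrix_mul continuousOn_const).matrix_mul continuousOn_const).mono hsub
  have cXe : ContinuousOn (fun s => transitionMatrix Xe s t₀ * V) (Icc t₀ t) :=
    ((hXe.1.matrix_mul continuousOn_const).matrix_mul continuousOn_const).mono hsub
  have key := norm_le_of_sub_eq_integral
    (D := fun s => transitionMatrix X s t₀ * V - transitionMatrix Xe s t₀ * V)
    (r := fun s => ℓ * ‖C s * (transitionMatrix X s t₀ * V)‖)
    (f := fun s => A s * (X s * ((X t₀)⁻¹ * V)) -
      (A s - L s * C s) * (Xe s * ((Xe t₀)⁻¹ * V)))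
    hM (cX.sub cXe) (continuousOn_const.mul ((hC.mono hsub).matrix_mul cX).norm)
    (fun s _ => by positivity)
    (fun s hs => by
      have hs0 : 0 ≤ s := h₀.trans hs.1
      have i1 := (hX.intervalIntegrable h₀ hs0).matrix_mul_const ((X t₀)⁻¹ * V)
      have i2 := (hXe.intervalIntegrable h₀ hs0).matrix_mul_const ((Xe t₀)⁻¹ * V)
      simp only [Matrix.mul_assoc _ (X _)] at i1
      simp only [Matrix.mul_assoc _ (Xe _)] at i2
      rw [intervalIntegral.integral_sub i1 i2, ← hX.sub_mul_eq_integral h₀ hs0,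
        ← hXe.sub_mul_eq_integral h₀ hs0]
      simp only [transitionMatrix, Matrix.mul_assoc]
      abel)
    (fun s hs => by
      have hs0 : 0 ≤ s := h₀.trans hs.1
      have e : A s * (X s * ((X t₀)⁻¹ * V)) - (A s - L s * C s) * (Xe s * ((Xe t₀)⁻¹ * V)) =
          (A s - L s * C s) * (transitionMatrix X s t₀ * V - transitionMatrix Xe s t₀ * V) +
            L s * (C s * (transitionMatrix X s t₀ * V)) := by
        simp only [transitionMatrix, Matrix.mul_sub, Matrix.sub_mul, Matrix.mul_assoc]
        abel
      rw [e]
      refine (norm_add_le _ _).trans (add_le_add ?_ ?_)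
      · exact (Matrix.l2_opNorm_mul _ _).trans
          (mul_le_mul_of_nonneg_right (hAM s hs0) (norm_nonneg _))
      · exact (Matrix.l2_opNorm_mul _ _).trans
          (mul_le_mul_of_nonneg_right (hLℓ s hs0) (norm_nonneg _))) t ⟨ht, le_rfl⟩
  refine key.trans (le_of_eq ?_)
  rw [transitionMatrix_self hX h₀, transitionMatrix_self hXe h₀, sub_self, norm_zero, zero_add,
    intervalIntegral.integral_const_mul]

end Observability

section Necessity

variable {α β ο : Type*} [Fintype α] [DecidableEq α] [Fintype β] [DecidableEq β]
  [Fintype ο] [DecidableEq ο]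
  {B₁₁ : ℝ → Matrix α α ℝ} {B₁₂ : ℝ → Matrix α β ℝ} {B₂₂ : ℝ → Matrix β β ℝ}
  {C₁ : ℝ → Matrix ο α ℝ} {C₂ : ℝ → Matrix ο β ℝ}
  {X : ℝ → Matrix (α ⊕ β) (α ⊕ β) ℝ}

lemma uniformlyBounded_fromBlocks_zero₂₁ (h₁ : UniformlyBounded B₁₁) (h₂ : UniformlyBounded B₁₂)
    (h₃ : UniformlyBounded B₂₂) :
    UniformlyBounded fun t => Matrix.fromBlocks (B₁₁ t) (B₁₂ t) 0 (B₂₂ t) := by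
  obtain ⟨a, ha⟩ := h₁
  obtain ⟨b, hb⟩ := h₂
  obtain ⟨d, hd⟩ := h₃
  exact ⟨a + b + d, fun t ht => (norm_fromBlocks_zero₂₁_le _ _ _).trans
    (add_le_add (add_le_add (ha t ht) (hb t ht)) (hd t ht))⟩

lemma uniformlyBounded_fromCols (h₁ : UniformlyBounded C₁) (h₂ : UniformlyBounded C₂) :
    UniformlyBounded fun t => Matrix.fromCols (C₁ t) (C₂ t) := by
  obtain ⟨a, ha⟩ := h₁
  obtain ⟨b, hb⟩ := h₂
  exact ⟨a + b, fun t ht => (norm_fromCols_le _ _).trans (add_le_add (ha t ht) (hb t ht))⟩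

lemma uniformlyBounded_sub_mul {ι : Type*} [Fintype ι] [DecidableEq ι] {A : ℝ → Matrix α ι ℝ}
    {L : ℝ → Matrix α ο ℝ} {C : ℝ → Matrix ο ι ℝ} (hA : UniformlyBounded A)
    (hL : UniformlyBounded L) (hC : UniformlyBounded C) :
    UniformlyBounded fun t => A t - L t * C t := by
  obtain ⟨a, ha⟩ := hA
  obtain ⟨l, hl0, hl⟩ := hL.exists_nonneg
  obtain ⟨c, hc⟩ := hC
  exact ⟨a + l * c, fun t ht => (norm_sub_le _ _).trans (add_le_add (ha t ht)
    ((Matrix.l2_opNorm_mul _ _).trans (mul_le_mul (hl t ht) (hc t ht) (norm_nonneg _) hl0)))⟩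

lemma fromCols_mul_inlMat_mul {ρ : Type*} (D₁ : Matrix ο α ℝ) (D₂ : Matrix ο β ℝ)
    (M : Matrix α ρ ℝ) : Matrix.fromCols D₁ D₂ * (inlMat α β * M) = D₁ * M := by
  rw [← Matrix.mul_assoc, inlMat, Matrix.fromCols_mul_fromRows]
  simp

/-- Trajectories of the antistable block expand, while those of the observer error system contract;
by `norm_sub_le_integral_output` the output has to account for the difference. -/
theorem uniformlyCompletelyObservable_of_detectable
    (cC₁ : ContinuousOn C₁ (Ici 0)) (cC₂ : ContinuousOn C₂ (Ici 0))
    (bB₁₁ : UniformlyBounded B₁₁) (bB₁₂ : UniformlyBounded B₁₂) (bB₂₂ : UniformlyBounded B₂₂)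
    (bC₁ : UniformlyBounded C₁) (bC₂ : UniformlyBounded C₂)
    (hF : IsFundamentalMatrix (fun t => Matrix.fromBlocks (B₁₁ t) (B₁₂ t) 0 (B₂₂ t)) X)
    (hX : ∀ t, 0 ≤ t → (X t).toBlocks₂₁ = 0) {K a : ℝ} (hK : 1 ≤ K) (ha : 0 < a)
    (hanti : ∀ t t₀, 0 ≤ t → t ≤ t₀ →
      ‖transitionMatrix (fun s => (X s).toBlocks₁₁) t t₀‖ ≤ K * Real.exp (a * (t - t₀)))
    (hdet : UniformlyExponentiallyDetectable
      (fun t => Matrix.fromBlocks (B₁₁ t) (B₁₂ t) 0 (B₂₂ t))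
      (fun t => Matrix.fromCols (C₁ t) (C₂ t))) :
    UniformlyCompletelyObservable B₁₁ C₁ := by
  obtain ⟨L, bL, Xe, hXe, μ, Ke, hμ, hKe, hstab⟩ := hdet
  obtain ⟨M, hM, hAM⟩ := (uniformlyBounded_sub_mul (uniformlyBounded_fromBlocks_zero₂₁ bB₁₁ bB₁₂
    bB₂₂) bL (uniformlyBounded_fromCols bC₁ bC₂)).exists_nonneg
  obtain ⟨ℓ, hℓ, hLℓ⟩ := bL.exists_nonneg
  obtain ⟨N, hN, hBN⟩ := bB₁₁.exists_nonneg
  obtain ⟨γ, hγ, hCγ⟩ := bC₁.exists_nonneg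
  have hF₁ := isFundamentalMatrix_toBlocks₁₁ hF hX
  set Y : ℝ → Matrix α α ℝ := fun t => (X t).toBlocks₁₁
  have cC : ContinuousOn (fun t => Matrix.fromCols (C₁ t) (C₂ t)) (Ici 0) := by
    have h : ∀ t, Matrix.fromCols (C₁ t) (C₂ t) =
        C₁ t * (inlMat α β)ᵀ + C₂ t * (inrMat α β)ᵀ := fun t => by
      ext i (j | j) <;> simp [inlMat, inrMat, Matrix.transpose_fromRows, Matrix.mul_fromCols]
    simp_rw [h]
    exact (cC₁.matrix_mul continuousOn_const).add (cC₂.matrix_mul continuousOn_const)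
  have hK0 : 0 < K := one_pos.trans_le hK
  have hKe0 : 0 < Ke := one_pos.trans_le hKe
  -- Over a time `σ` the expansion factor `exp (a σ) / K` exceeds `Ke + 1`.
  set σ : ℝ := K * (Ke + 1) / a
  have hσ : 0 < σ := by positivity
  have hexp : K * (Ke + 1) ≤ Real.exp (a * σ) := by
    have h : a * σ = K * (Ke + 1) := by simp only [σ]; field_simp
    rw [h]
    linarith [Real.add_one_le_exp (K * (Ke + 1))]
  set c : ℝ := (ℓ * Real.exp (M * σ) + 1)⁻¹
  have hc : 0 < c := by positivity
  have hy : ∀ t₀, 0 ≤ t₀ → ∀ x : α → ℝ, c * ‖Matrix.replicateCol Unit x‖ ≤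
      ∫ s in t₀..t₀ + σ, ‖C₁ s * (transitionMatrix Y s t₀ * Matrix.replicateCol Unit x)‖ := by
    intro t₀ h₀ x
    set V := Matrix.replicateCol Unit x
    have ht : t₀ ≤ t₀ + σ := by linarith
    have ht0 : 0 ≤ t₀ + σ := by linarith
    have hfac : ∀ s, 0 ≤ s → transitionMatrix X s t₀ * (inlMat α β * V) =
        inlMat α β * (transitionMatrix Y s t₀ * V) := fun s hs => by
      rw [← Matrix.mul_assoc, transitionMatrix_mul_inlMat (hF.isUnit h₀) (hX t₀ h₀) (hX s hs),
        Matrix.mul_assoc]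
    have h1 := norm_sub_le_integral_output hF hXe cC hM hℓ hAM hLℓ h₀ ht (inlMat α β * V)
    have h2 : ∫ s in t₀..t₀ + σ, ‖Matrix.fromCols (C₁ s) (C₂ s) *
        (transitionMatrix X s t₀ * (inlMat α β * V))‖ =
        ∫ s in t₀..t₀ + σ, ‖C₁ s * (transitionMatrix Y s t₀ * V)‖ :=
      intervalIntegral.integral_congr fun s hs => by
        rw [uIcc_of_le ht] at hs
        simp only [hfac s (h₀.trans hs.1), fromCols_mul_inlMat_mul]
    rw [h2, hfac _ ht0, add_sub_cancel_left] at h1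
    set I := ∫ s in t₀..t₀ + σ, ‖C₁ s * (transitionMatrix Y s t₀ * V)‖
    have hI : 0 ≤ I := intervalIntegral.integral_nonneg ht fun _ _ => norm_nonneg _
    have h3 : ‖transitionMatrix Xe (t₀ + σ) t₀ * (inlMat α β * V)‖ ≤ Ke * ‖V‖ := by
      refine (Matrix.l2_opNorm_mul _ _).trans ?_
      rw [norm_inlMat_mul]
      gcongr
      refine (hstab t₀ (t₀ + σ) h₀ ht).trans (mul_le_of_le_one_right hKe0.le ?_)
      rw [Real.exp_le_one_iff, add_sub_cancel_left]
      nlinarith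
    have h4 : (Ke + 1) * ‖V‖ ≤ ‖transitionMatrix Y (t₀ + σ) t₀ * V‖ := by
      have h5 : V = transitionMatrix Y t₀ (t₀ + σ) * (transitionMatrix Y (t₀ + σ) t₀ * V) := by
        rw [← Matrix.mul_assoc, transitionMatrix_mul hF₁ ht0, transitionMatrix_self hF₁ h₀,
          Matrix.one_mul]
      have h6 : ‖V‖ ≤ K * Real.exp (a * (t₀ - (t₀ + σ))) *
          ‖transitionMatrix Y (t₀ + σ) t₀ * V‖ := by
        conv_lhs => rw [h5]
        exact (Matrix.l2_opNorm_mul _ _).trans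
          (mul_le_mul_of_nonneg_right (hanti t₀ (t₀ + σ) h₀ ht) (norm_nonneg _))
      have h7 : a * (t₀ - (t₀ + σ)) = -(a * σ) := by ring
      rw [h7, Real.exp_neg, ← div_eq_mul_inv, div_mul_eq_mul_div,
        le_div_iff₀ (Real.exp_pos _)] at h6
      have h8 : ‖V‖ * (K * (Ke + 1)) ≤ ‖V‖ * Real.exp (a * σ) := by gcongr
      refine le_of_mul_le_mul_left ?_ hK0
      linarith
    have h9 : ‖transitionMatrix Y (t₀ + σ) t₀ * V‖ ≤ Ke * ‖V‖ + ℓ * I * Real.exp (M * σ) := by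
      rw [← norm_inlMat_mul (β := β)]
      have := norm_sub_norm_le (inlMat α β * (transitionMatrix Y (t₀ + σ) t₀ * V))
        (transitionMatrix Xe (t₀ + σ) t₀ * (inlMat α β * V))
      linarith
    rw [inv_mul_le_iff₀ (by positivity)]
    linarith
  refine ⟨Y, hF₁, c ^ 2 / σ, σ * (γ * Real.exp (N * σ)) ^ 2 + 1, σ, by positivity, by positivity,
    hσ, fun t₀ h₀ => ?_⟩
  have ht : t₀ < t₀ + σ := by linarith
  have ht0 : 0 ≤ t₀ + σ := by linarith
  have hH := observabilityGramian_isHermitian hF₁ cC₁ h₀ ht0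
  have cy : ∀ x : α → ℝ, ContinuousOn
      (fun s => ‖C₁ s * (transitionMatrix Y s t₀ * Matrix.replicateCol Unit x)‖)
      (Icc t₀ (t₀ + σ)) := fun x =>
    ((cC₁.matrix_mul ((hF₁.1.matrix_mul continuousOn_const).matrix_mul
      continuousOn_const)).norm).mono (Ici_subset_of_nonneg h₀)
  rw [posSemidef_sub_smul_one_iff hH, posSemidef_smul_one_sub_iff hH]
  refine ⟨fun x => ?_, fun x => ?_⟩
  · have h1 := sq_div_le_integral_sq ht (cy x) (by positivity) (hy t₀ h₀ x)
    rw [mul_pow, norm_replicateCol_sq, add_sub_cancel_left] at h1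
    rw [dotProduct_observabilityGramian hF₁ cC₁ h₀ ht0]
    refine le_trans (le_of_eq ?_) h1
    ring
  · rw [dotProduct_observabilityGramian hF₁ cC₁ h₀ ht0]
    have h1 : ∫ s in t₀..t₀ + σ,
        ‖C₁ s * (transitionMatrix Y s t₀ * Matrix.replicateCol Unit x)‖ ^ 2 ≤
        ∫ _s in t₀..t₀ + σ, (γ * Real.exp (N * σ)) ^ 2 * (x ⬝ᵥ x) := by
      refine intervalIntegral.integral_mono_on ht.le
        (((cy x).pow 2).intervalIntegrable_of_Icc ht.le) intervalIntegrable_const fun s hs => ?_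
      rw [← norm_replicateCol_sq, ← mul_pow]
      refine pow_le_pow_left₀ (norm_nonneg _) ?_ 2
      have hs0 : 0 ≤ s := h₀.trans hs.1
      have h2 : ‖transitionMatrix Y s t₀‖ ≤ Real.exp (N * σ) :=
        (norm_transitionMatrix_le hF₁ hN hBN h₀ hs.1).trans
          (Real.exp_le_exp.2 (mul_le_mul_of_nonneg_left (by linarith [hs.2]) hN))
      calc _ ≤ ‖C₁ s‖ * (‖transitionMatrix Y s t₀‖ * ‖Matrix.replicateCol Unit x‖) :=
            (Matrix.l2_opNorm_mul _ _).trans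
              (mul_le_mul_of_nonneg_left (Matrix.l2_opNorm_mul _ _) (norm_nonneg _))
        _ ≤ γ * (Real.exp (N * σ) * ‖Matrix.replicateCol Unit x‖) :=
            mul_le_mul (hCγ s hs0) (mul_le_mul_of_nonneg_right h2 (norm_nonneg _))
              (by positivity) hγ
        _ = _ := by ring
    rw [intervalIntegral.integral_const, smul_eq_mul, add_sub_cancel_left] at h1
    have h2 := zero_le_dotProduct_self x
    linarith

end Necessity

section Sufficiency

variable {ι ο : Type*} [Fintype ι] [DecidableEq ι] [Fintype ο] [DecidableEq ο]

variable {A Y : ℝ → Matrix ι ι ℝ} {C : ℝ → Matrix ο ι ℝ}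

/-! ### A stabilizing gain for an antistable observable system -/

lemma dotProduct_transpose_mul_mul (P N : Matrix ι ι ℝ) (x : ι → ℝ) :
    x ⬝ᵥ (Pᵀ * N * P) *ᵥ x = (P *ᵥ x) ⬝ᵥ N *ᵥ (P *ᵥ x) := by
  rw [Matrix.mul_assoc, ← Matrix.mulVec_mulVec, Matrix.dotProduct_mulVec, Matrix.vecMul_transpose,
    ← Matrix.mulVec_mulVec]

lemma continuousOn_transpose_mul_self (hC : ContinuousOn C (Ici 0)) (hY : ContinuousOn Y (Ici 0)) :
    ContinuousOn (fun s => (C s * Y s)ᵀ * (C s * Y s)) (Ici 0) :=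
  (hC.matrix_mul hY).matrix_transpose.matrix_mul (hC.matrix_mul hY)

lemma observabilityGramian_eq (hC : ContinuousOn C (Ici 0)) (hY : ContinuousOn Y (Ici 0))
    {t₀ t₁ : ℝ} (h₀ : 0 ≤ t₀) (h₁ : 0 ≤ t₁) :
    observabilityGramian Y C t₁ t₀ =
      ((Y t₀)⁻¹)ᵀ * (∫ s in t₀..t₁, (C s * Y s)ᵀ * (C s * Y s)) * (Y t₀)⁻¹ := by
  rw [observabilityGramian, ← integral_mul_mul _ _
    (intervalIntegrable_of_continuousOn_Ici (continuousOn_transpose_mul_self hC hY) h₀ h₁)]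
  congr 1 with s
  simp only [transitionMatrix, Matrix.transpose_mul, Matrix.mul_assoc]

lemma dotProduct_integral_transpose_mul_self_nonneg (hC : ContinuousOn C (Ici 0))
    (hY : ContinuousOn Y (Ici 0)) {r t : ℝ} (hr : 0 ≤ r) (ht : r ≤ t) (x : ι → ℝ) :
    0 ≤ x ⬝ᵥ (∫ s in r..t, (C s * Y s)ᵀ * (C s * Y s)) *ᵥ x := by
  rw [dotProduct_integral_mulVec (intervalIntegrable_of_continuousOn_Ici
    (continuousOn_transpose_mul_self hC hY) hr (hr.trans ht))]
  refine intervalIntegral.integral_nonneg ht fun s _ => ?_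
  rw [dotProduct_transpose_mul_self]
  exact zero_le_dotProduct_self _

/-- The information accumulated from the output on `[0, t]`, in the coordinates of the initial
value, together with the information `1` that is assumed known at the start. -/
noncomputable def information (Y : ℝ → Matrix ι ι ℝ) (C : ℝ → Matrix ο ι ℝ) (t : ℝ) :
    Matrix ι ι ℝ :=
  1 + ∫ s in (0 : ℝ)..t, (C s * Y s)ᵀ * (C s * Y s)

/-- The accumulated information in the coordinates of the current state `Y(t) x`. -/
noncomputable def currentInformation (Y : ℝ → Matrix ι ι ℝ) (C : ℝ → Matrix ο ι ℝ) (t : ℝ) :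
    Matrix ι ι ℝ :=
  ((Y t)⁻¹)ᵀ * information Y C t * (Y t)⁻¹

lemma information_eq_add (hC : ContinuousOn C (Ici 0)) (hY : ContinuousOn Y (Ici 0))
    {r t : ℝ} (hr : 0 ≤ r) (ht : 0 ≤ t) :
    information Y C t = information Y C r + ∫ s in r..t, (C s * Y s)ᵀ * (C s * Y s) := by
  have hi := fun {a b : ℝ} (ha : 0 ≤ a) (hb : 0 ≤ b) =>
    intervalIntegrable_of_continuousOn_Ici (continuousOn_transpose_mul_self hC hY) ha hb
  rw [information, information, add_assoc,
    intervalIntegral.integral_add_adjacent_intervals (hi le_rfl hr) (hi hr ht)]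

lemma dotProduct_self_le_information (hC : ContinuousOn C (Ici 0)) (hY : ContinuousOn Y (Ici 0))
    {t : ℝ} (ht : 0 ≤ t) (x : ι → ℝ) : x ⬝ᵥ x ≤ x ⬝ᵥ information Y C t *ᵥ x := by
  rw [information, Matrix.add_mulVec, dotProduct_add, Matrix.one_mulVec]
  exact le_add_of_nonneg_right
    (dotProduct_integral_transpose_mul_self_nonneg hC hY le_rfl ht x)

lemma isUnit_information (hC : ContinuousOn C (Ici 0)) (hY : ContinuousOn Y (Ici 0))
    {t : ℝ} (ht : 0 ≤ t) : IsUnit (information Y C t) :=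
  (isUnit_and_norm_inv_le one_pos fun x => by
    rw [one_mul]; exact dotProduct_self_le_information hC hY ht x).1

lemma currentInformation_inv {t : ℝ} (hu : IsUnit (Y t)) :
    (currentInformation Y C t)⁻¹ = Y t * (information Y C t)⁻¹ * (Y t)ᵀ := by
  have hd := (Matrix.isUnit_iff_isUnit_det _).1 hu
  rw [currentInformation, Matrix.mul_inv_rev, Matrix.mul_inv_rev,
    Matrix.nonsing_inv_nonsing_inv _ hd, ← Matrix.transpose_nonsing_inv,
    Matrix.nonsing_inv_nonsing_inv _ hd, Matrix.mul_assoc]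

/-- Uniform complete observability bounds the current information from below: for `t ≤ σ` by the
initial information, later on by what the last time window of length `σ` contributes. -/
lemma exists_le_currentInformation (hY : IsFundamentalMatrix A Y) (hC : ContinuousOn C (Ici 0))
    (bA : UniformlyBounded A) {β σ : ℝ} (hβ : 0 < β) (hσ : 0 < σ)
    (hG : ∀ t₀, 0 ≤ t₀ → ∀ x,
      β * (x ⬝ᵥ x) ≤ x ⬝ᵥ observabilityGramian Y C (t₀ + σ) t₀ *ᵥ x) :
    ∃ c, 0 < c ∧ ∀ t, 0 ≤ t → ∀ x, c * (x ⬝ᵥ x) ≤ x ⬝ᵥ currentInformation Y C t *ᵥ x := by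
  obtain ⟨M, hM, hAM⟩ := bA.exists_nonneg
  set b : ℝ := Real.exp (M * σ) * (‖Y 0‖ + 1)
  have hb : 0 < b := by positivity
  refine ⟨min 1 β / b ^ 2, by positivity, fun t ht x => ?_⟩
  rw [currentInformation, dotProduct_transpose_mul_mul]
  set z := (Y t)⁻¹ *ᵥ x
  have hx : x = Y t *ᵥ z := by
    rw [Matrix.mulVec_mulVec, mul_inv_of_isUnit (hY.isUnit ht), Matrix.one_mulVec]
  have hexp : ∀ r, 0 ≤ r → r ≤ t → t ≤ r + σ →
      ‖transitionMatrix Y t r‖ ≤ Real.exp (M * σ) := fun r hr hrt htr =>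
    (norm_transitionMatrix_le hY hM hAM hr hrt).trans
      (Real.exp_le_exp.2 (mul_le_mul_of_nonneg_left (by linarith) hM))
  rw [div_mul_eq_mul_div, div_le_iff₀ (by positivity)]
  have hxx := zero_le_dotProduct_self x
  have hzz := zero_le_dotProduct_self z
  rcases le_total t σ with h | h
  · have h1 : ‖Y t‖ ≤ b := by
      have h2 : Y t = transitionMatrix Y t 0 * Y 0 := by
        rw [transitionMatrix, Matrix.mul_assoc, inv_mul_of_isUnit (hY.isUnit le_rfl),
          Matrix.mul_one]
      rw [h2]
      refine (Matrix.l2_opNorm_mul _ _).trans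
        (mul_le_mul (hexp 0 le_rfl ht (by linarith)) (by linarith) (norm_nonneg _) (by positivity))
    have h3 : x ⬝ᵥ x ≤ b ^ 2 * (z ⬝ᵥ z) := by
      rw [hx]
      refine (dotProduct_mulVec_self_le _ _).trans ?_
      gcongr
    have h4 := dotProduct_self_le_information hC hY.1 ht z
    calc min 1 β * (x ⬝ᵥ x) ≤ 1 * (x ⬝ᵥ x) := by gcongr; exact min_le_left _ _
      _ ≤ b ^ 2 * (z ⬝ᵥ z) := by rwa [one_mul]
      _ ≤ _ := by rw [mul_comm]; gcongr
  · have hr : 0 ≤ t - σ := by linarith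
    have hrt : t - σ ≤ t := by linarith
    set w := Y (t - σ) *ᵥ z
    have hz : z = (Y (t - σ))⁻¹ *ᵥ w := by
      rw [Matrix.mulVec_mulVec, inv_mul_of_isUnit (hY.isUnit hr), Matrix.one_mulVec]
    have hxw : x = transitionMatrix Y t (t - σ) *ᵥ w := by
      rw [transitionMatrix, ← Matrix.mulVec_mulVec, ← hz, ← hx]
    have h1 := hG (t - σ) hr w
    rw [sub_add_cancel, observabilityGramian_eq hC hY.1 hr ht, dotProduct_transpose_mul_mul,
      ← hz] at h1
    have h2 : z ⬝ᵥ (∫ s in t - σ..t, (C s * Y s)ᵀ * (C s * Y s)) *ᵥ z ≤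
        z ⬝ᵥ information Y C t *ᵥ z := by
      rw [information_eq_add hC hY.1 hr ht, Matrix.add_mulVec, dotProduct_add]
      have := dotProduct_self_le_information hC hY.1 hr z
      linarith
    have hww := zero_le_dotProduct_self w
    have h3 : x ⬝ᵥ x ≤ b ^ 2 * (w ⬝ᵥ w) := by
      rw [hxw]
      refine (dotProduct_mulVec_self_le _ _).trans ?_
      gcongr
      refine (hexp _ hr hrt (by linarith)).trans (le_mul_of_one_le_right (by positivity) ?_)
      linarith [norm_nonneg (Y 0)]
    calc min 1 β * (x ⬝ᵥ x) ≤ β * (x ⬝ᵥ x) := by gcongr; exact min_le_right _ _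
      _ ≤ β * (b ^ 2 * (w ⬝ᵥ w)) := by gcongr
      _ = (β * (w ⬝ᵥ w)) * b ^ 2 := by ring
      _ ≤ _ := by gcongr; exact h1.trans h2

lemma integral_exp_le {a t : ℝ} (ha : 0 < a) :
    ∫ s in (0 : ℝ)..t, Real.exp (a * (s - t)) ≤ 1 / a := by
  have hd : ∀ s ∈ uIcc 0 t, HasDerivAt (fun s => Real.exp (a * (s - t)) / a)
      (Real.exp (a * (s - t))) s := fun s _ => by
    have h := ((((hasDerivAt_id s).sub_const t).const_mul a).exp).div_const a
    convert! h using 1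
    simp only [id]
    field_simp
  rw [intervalIntegral.integral_eq_sub_of_hasDerivAt hd
    (Continuous.intervalIntegrable (by fun_prop) _ _)]
  simp only [sub_self, mul_zero, Real.exp_zero]
  have : 0 ≤ Real.exp (a * (0 - t)) / a := by positivity
  linarith

/-- Antistability bounds the current information from above, because old outputs are forgotten. -/
lemma exists_norm_currentInformation_le (hY : IsFundamentalMatrix A Y)
    (hC : ContinuousOn C (Ici 0)) (bC : UniformlyBounded C) {K a : ℝ} (hK : 1 ≤ K) (ha : 0 < a)
    (hanti : ∀ t t₀, 0 ≤ t → t ≤ t₀ →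
      ‖transitionMatrix Y t t₀‖ ≤ K * Real.exp (a * (t - t₀))) :
    ∃ c, 0 ≤ c ∧ ∀ t, 0 ≤ t → ‖currentInformation Y C t‖ ≤ c := by
  obtain ⟨γ, hγ, hCγ⟩ := bC.exists_nonneg
  have hK0 : 0 < K := one_pos.trans_le hK
  refine ⟨(‖(Y 0)⁻¹‖ * K) ^ 2 + (γ * K) ^ 2 * (1 / (2 * a)), by positivity, fun t ht => ?_⟩
  have e : currentInformation Y C t = ((Y t)⁻¹)ᵀ * (Y t)⁻¹ +
      ∫ s in (0 : ℝ)..t, (C s * transitionMatrix Y s t)ᵀ * (C s * transitionMatrix Y s t) := by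
    have h := observabilityGramian_eq hC hY.1 ht le_rfl
    simp_rw [observabilityGramian, gramian_integrand_eq] at h
    rw [intervalIntegral.integral_symm, intervalIntegral.integral_symm 0 t, Matrix.mul_neg,
      Matrix.neg_mul, neg_inj] at h
    rw [h, currentInformation, information, Matrix.mul_add, Matrix.add_mul, Matrix.mul_one]
  rw [e]
  refine (norm_add_le _ _).trans (add_le_add ?_ ?_)
  · have h1 : ‖(Y t)⁻¹‖ ≤ ‖(Y 0)⁻¹‖ * K := by
      have h2 : (Y t)⁻¹ = (Y 0)⁻¹ * transitionMatrix Y 0 t := by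
        rw [transitionMatrix, ← Matrix.mul_assoc, inv_mul_of_isUnit (hY.isUnit le_rfl),
          Matrix.one_mul]
      rw [h2]
      refine (Matrix.l2_opNorm_mul _ _).trans (mul_le_mul_of_nonneg_left ?_ (norm_nonneg _))
      refine (hanti 0 t le_rfl ht).trans (mul_le_of_le_one_right hK0.le ?_)
      rw [Real.exp_le_one_iff]
      nlinarith
    refine (Matrix.l2_opNorm_mul _ _).trans ?_
    rw [norm_transpose, ← sq]
    exact pow_le_pow_left₀ (norm_nonneg _) h1 2
  · have h1 : ‖∫ s in (0 : ℝ)..t, (C s * transitionMatrix Y s t)ᵀ * (C s * transitionMatrix Y s t)‖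
        ≤ ∫ s in (0 : ℝ)..t, (γ * K) ^ 2 * Real.exp (2 * a * (s - t)) := by
      refine intervalIntegral.norm_integral_le_of_norm_le ht
        (Filter.Eventually.of_forall fun s hs => ?_)
        (Continuous.intervalIntegrable (by fun_prop) _ _)
      refine (Matrix.l2_opNorm_mul _ _).trans ?_
      rw [norm_transpose, ← sq]
      have h2 : ‖C s * transitionMatrix Y s t‖ ≤ γ * (K * Real.exp (a * (s - t))) :=
        (Matrix.l2_opNorm_mul _ _).trans
          (mul_le_mul (hCγ s hs.1.le) (hanti s t hs.1.le hs.2) (norm_nonneg _) hγ)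
      refine (pow_le_pow_left₀ (norm_nonneg _) h2 2).trans (le_of_eq ?_)
      have h3 : 2 * a * (s - t) = a * (s - t) + a * (s - t) := by ring
      rw [h3, Real.exp_add]
      ring
    rw [intervalIntegral.integral_const_mul] at h1
    exact h1.trans (mul_le_mul_of_nonneg_left (integral_exp_le (by positivity)) (by positivity))

/-- With the gain `L = W⁻¹ Cᵀ`, where `W` is the current information, the matrix `Y N⁻¹`, where `N`
is the information in initial coordinates, is a fundamental matrix of `e' = (A - L C) e`. Its
transition matrix is `W(t)⁻¹ Φ(s,t)ᵀ W(s)`, which decays since `Φ` is stable backward in time. -/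
theorem exists_stabilizing_gain (hY : IsFundamentalMatrix A Y) (cA : ContinuousOn A (Ici 0))
    (hC : ContinuousOn C (Ici 0)) (bA : UniformlyBounded A) (bC : UniformlyBounded C)
    {K a : ℝ} (hK : 1 ≤ K) (ha : 0 < a)
    (hanti : ∀ t t₀, 0 ≤ t → t ≤ t₀ →
      ‖transitionMatrix Y t t₀‖ ≤ K * Real.exp (a * (t - t₀)))
    {β σ : ℝ} (hβ : 0 < β) (hσ : 0 < σ)
    (hG : ∀ t₀, 0 ≤ t₀ → ∀ x,
      β * (x ⬝ᵥ x) ≤ x ⬝ᵥ observabilityGramian Y C (t₀ + σ) t₀ *ᵥ x) :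
    ∃ L : ℝ → Matrix ι ο ℝ, ContinuousOn L (Ici 0) ∧ UniformlyBounded L ∧
      ∃ Z, IsFundamentalMatrix (fun t => A t - L t * C t) Z ∧ ∃ K', 0 ≤ K' ∧
        ∀ t₀ t, 0 ≤ t₀ → t₀ ≤ t →
          ‖transitionMatrix Z t t₀‖ ≤ K' * Real.exp (-a * (t - t₀)) := by
  obtain ⟨c, hc, hlow⟩ := exists_le_currentInformation hY hC bA hβ hσ hG
  obtain ⟨d, hd, hup⟩ := exists_norm_currentInformation_le hY hC bC hK ha hanti
  obtain ⟨γ, hγ, hCγ⟩ := bC.exists_nonneg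
  have hK0 : 0 < K := one_pos.trans_le hK
  have hWinv : ∀ t, 0 ≤ t → ‖(currentInformation Y C t)⁻¹‖ ≤ c⁻¹ := fun t ht =>
    (isUnit_and_norm_inv_le hc (hlow t ht)).2
  have cf := continuousOn_transpose_mul_self hC hY.1
  have cN : ContinuousOn (information Y C) (Ici 0) :=
    continuousOn_const.add (continuousOn_integral_of_continuousOn_Ici cf)
  have uN : ∀ t, 0 ≤ t → IsUnit (information Y C t) := fun t ht => isUnit_information hC hY.1 ht
  have cNi : ContinuousOn (fun t => (information Y C t)⁻¹) (Ici 0) := cN.matrix_inv uN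
  set L : ℝ → Matrix ι ο ℝ := fun t => Y t * (information Y C t)⁻¹ * (Y t)ᵀ * (C t)ᵀ
  have cL : ContinuousOn L (Ici 0) :=
    ((hY.1.matrix_mul cNi).matrix_mul hY.1.matrix_transpose).matrix_mul hC.matrix_transpose
  refine ⟨L, cL, ⟨c⁻¹ * γ, fun t ht => ?_⟩, fun t => Y t * (information Y C t)⁻¹, ?_,
    c⁻¹ * K * d, by positivity, fun s t hs hst => ?_⟩
  · simp only [L]
    rw [← currentInformation_inv (hY.isUnit ht)]
    refine (Matrix.l2_opNorm_mul _ _).trans ?_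
    rw [norm_transpose]
    exact mul_le_mul (hWinv t ht) (hCγ t ht) (norm_nonneg _) (by positivity)
  · refine isFundamentalMatrix_of_hasDerivAt (cA.sub (cL.matrix_mul hC)) (hY.1.matrix_mul cNi)
      (fun t ht => (hY.isUnit ht).mul (Matrix.isUnit_nonsing_inv_iff.2 (uN t ht)))
      fun t ht => ?_
    have hN : HasDerivAt (information Y C) ((C t * Y t)ᵀ * (C t * Y t)) t :=
      (hasDerivAt_integral_of_continuousOn_Ici cf ht).const_add 1
    convert! (hY.hasDerivAt cA ht).matrix_mul (hN.matrix_inv (uN t ht.le)) using 1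
    simp only [L, Matrix.transpose_mul, Matrix.mul_neg, Matrix.neg_mul, Matrix.add_mul,
      Matrix.mul_assoc, sub_eq_add_neg]
  · have ht : 0 ≤ t := hs.trans hst
    have e : transitionMatrix (fun t => Y t * (information Y C t)⁻¹) t s =
        (currentInformation Y C t)⁻¹ * (transitionMatrix Y s t)ᵀ * currentInformation Y C s := by
      have h1 : (Y t)ᵀ * ((Y t)⁻¹)ᵀ = 1 := by
        rw [← Matrix.transpose_mul, inv_mul_of_isUnit (hY.isUnit ht), Matrix.transpose_one]
      have h2 : (Y s)ᵀ * ((Y s)⁻¹)ᵀ = 1 := by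
        rw [← Matrix.transpose_mul, inv_mul_of_isUnit (hY.isUnit hs), Matrix.transpose_one]
      rw [currentInformation_inv (hY.isUnit ht), transitionMatrix, transitionMatrix,
        Matrix.mul_inv_rev, currentInformation, Matrix.transpose_mul,
        Matrix.nonsing_inv_nonsing_inv _ ((Matrix.isUnit_iff_isUnit_det _).1 (uN s hs))]
      calc Y t * (information Y C t)⁻¹ * (information Y C s * (Y s)⁻¹)
          = Y t * (information Y C t)⁻¹ * ((Y t)ᵀ * ((Y t)⁻¹)ᵀ) * ((Y s)ᵀ * ((Y s)⁻¹)ᵀ) *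
              (information Y C s * (Y s)⁻¹) := by
            rw [h1, h2, Matrix.mul_one, Matrix.mul_one]
        _ = _ := by simp only [Matrix.mul_assoc]
    rw [e]
    have h3 := hanti s t hs hst
    have h4 : a * (s - t) = -a * (t - s) := by ring
    rw [h4] at h3
    calc _ ≤ ‖(currentInformation Y C t)⁻¹‖ * ‖transitionMatrix Y s t‖ *
          ‖currentInformation Y C s‖ := by
          refine (Matrix.l2_opNorm_mul _ _).trans
            (mul_le_mul_of_nonneg_right ?_ (norm_nonneg _))
          rw [← norm_transpose (transitionMatrix Y s t)]
          exact Matrix.l2_opNorm_mul _ _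
      _ ≤ c⁻¹ * (K * Real.exp (-a * (t - s))) * d := by
          have := hWinv t ht
          have := hup s hs
          gcongr
      _ = _ := by ring

end Sufficiency

/-! ### Cascades of exponentially stable systems -/

section Cascade

variable {α β : Type*} [Fintype α] [DecidableEq α] [Fintype β] [DecidableEq β]

/-- `(t - s) exp (-a (t - s))` decays exponentially at the rate `a / 2`. -/
lemma mul_exp_neg_le {a x : ℝ} (ha : 0 < a) :
    x * Real.exp (-a * x) ≤ 2 / a * Real.exp (-(a / 2) * x) := by
  have h1 : -a * x = -(a / 2 * x) + -(a / 2) * x := by ring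
  rw [h1, Real.exp_add, ← mul_assoc]
  refine mul_le_mul_of_nonneg_right ?_ (Real.exp_nonneg _)
  have h2 := Real.add_one_le_exp (a / 2 * x)
  rw [Real.exp_neg, ← div_eq_mul_inv, div_le_div_iff₀ (Real.exp_pos _) ha]
  linarith

/-- A block triangular system is exponentially stable if its diagonal blocks are and the coupling
is bounded. The off-diagonal block of the fundamental matrix comes from variation of constants. -/
theorem uniformlyExponentiallyStable_fromBlocks {A Z : ℝ → Matrix α α ℝ} {D : ℝ → Matrix α β ℝ}
    {B Y : ℝ → Matrix β β ℝ} (hZ : IsFundamentalMatrix A Z) (hY : IsFundamentalMatrix B Y)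
    (cA : ContinuousOn A (Ici 0)) (cD : ContinuousOn D (Ici 0)) (cB : ContinuousOn B (Ici 0))
    (bD : UniformlyBounded D) {K₁ K₂ a : ℝ} (hK₁ : 0 ≤ K₁) (hK₂ : 0 ≤ K₂) (ha : 0 < a)
    (h₁ : ∀ t₀ t, 0 ≤ t₀ → t₀ ≤ t →
      ‖transitionMatrix Z t t₀‖ ≤ K₁ * Real.exp (-a * (t - t₀)))
    (h₂ : ∀ t₀ t, 0 ≤ t₀ → t₀ ≤ t →
      ‖transitionMatrix Y t t₀‖ ≤ K₂ * Real.exp (-a * (t - t₀))) :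
    UniformlyExponentiallyStable fun t => Matrix.fromBlocks (A t) (D t) 0 (B t) := by
  obtain ⟨d, hd, hDd⟩ := bD.exists_nonneg
  have cf : ContinuousOn (fun s => (Z s)⁻¹ * D s * Y s) (Ici 0) :=
    ((hZ.1.matrix_inv fun t ht => hZ.isUnit ht).matrix_mul cD).matrix_mul hY.1
  set J : ℝ → Matrix α β ℝ := fun t => ∫ s in (0 : ℝ)..t, (Z s)⁻¹ * D s * Y s
  have cJ : ContinuousOn J (Ici 0) := continuousOn_integral_of_continuousOn_Ici cf
  have hu : ∀ t, 0 ≤ t → IsUnit (Matrix.fromBlocks (Z t) (Z t * J t) 0 (Y t)) := fun t ht =>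
    Matrix.isUnit_fromBlocks_zero₂₁.2 ⟨hZ.isUnit ht, hY.isUnit ht⟩
  refine ⟨fun t => Matrix.fromBlocks (Z t) (Z t * J t) 0 (Y t),
    isFundamentalMatrix_of_hasDerivAt (continuousOn_fromBlocks_zero₂₁ cA cD cB)
      (continuousOn_fromBlocks_zero₂₁ hZ.1 (hZ.1.matrix_mul cJ) hY.1) hu fun t ht => ?_,
    a / 2, K₁ + K₁ * K₂ * d * (2 / a) + K₂ + 1, by positivity,
    le_add_of_nonneg_left (by positivity), fun s t hs hst => ?_⟩
  · have hJ : HasDerivAt J ((Z t)⁻¹ * D t * Y t) t := hasDerivAt_integral_of_continuousOn_Ici cf ht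
    have hZt := hZ.hasDerivAt cA ht
    convert! hasDerivAt_fromBlocks_zero₂₁ hZt (hZt.matrix_mul hJ) (hY.hasDerivAt cB ht) using 1
    rw [Matrix.fromBlocks_multiply]
    simp only [← Matrix.mul_assoc, mul_inv_of_isUnit (hZ.isUnit ht.le)]
    simp
  · have ht : 0 ≤ t := hs.trans hst
    have hi := intervalIntegrable_of_continuousOn_Ici cf hs ht
    have e : transitionMatrix (fun t => Matrix.fromBlocks (Z t) (Z t * J t) 0 (Y t)) t s =
        Matrix.fromBlocks (transitionMatrix Z t s)
          (∫ r in s..t, transitionMatrix Z t r * D r * transitionMatrix Y r s) 0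
          (transitionMatrix Y t s) := by
      have hJ : J t - J s = ∫ r in s..t, (Z r)⁻¹ * D r * Y r :=
        intervalIntegral.integral_interval_sub_left
          (intervalIntegrable_of_continuousOn_Ici cf le_rfl ht)
          (intervalIntegrable_of_continuousOn_Ici cf le_rfl hs)
      have hI : ∫ r in s..t, transitionMatrix Z t r * D r * transitionMatrix Y r s =
          Z t * (J t - J s) * (Y s)⁻¹ := by
        rw [hJ, ← integral_mul_mul _ _ hi]
        simp only [transitionMatrix, Matrix.mul_assoc]
      rw [hI, transitionMatrix, inv_eq_fromBlocks (hu s hs) (by simp)]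
      simp only [Matrix.toBlocks_fromBlocks₁₁, Matrix.toBlocks_fromBlocks₁₂,
        Matrix.toBlocks_fromBlocks₂₂, Matrix.fromBlocks_multiply, transitionMatrix,
        ← Matrix.mul_assoc, inv_mul_of_isUnit (hZ.isUnit hs)]
      simp [Matrix.mul_add, Matrix.add_mul, Matrix.mul_assoc, sub_eq_neg_add]
    rw [e]
    refine (norm_fromBlocks_zero₂₁_le _ _ _).trans ?_
    have hle : Real.exp (-a * (t - s)) ≤ Real.exp (-(a / 2) * (t - s)) :=
      Real.exp_le_exp.2 (by nlinarith)
    have hI : ‖∫ r in s..t, transitionMatrix Z t r * D r * transitionMatrix Y r s‖ ≤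
        K₁ * K₂ * d * (2 / a) * Real.exp (-(a / 2) * (t - s)) := by
      have h3 : ‖∫ r in s..t, transitionMatrix Z t r * D r * transitionMatrix Y r s‖ ≤
          ∫ _r in s..t, K₁ * K₂ * d * Real.exp (-a * (t - s)) := by
        refine intervalIntegral.norm_integral_le_of_norm_le hst
          (Filter.Eventually.of_forall fun r hr => ?_) intervalIntegrable_const
        have hr0 : 0 ≤ r := hs.trans hr.1.le
        have h4 : -a * (t - s) = -a * (t - r) + -a * (r - s) := by ring
        calc _ ≤ ‖transitionMatrix Z t r‖ * ‖D r‖ * ‖transitionMatrix Y r s‖ :=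
              (Matrix.l2_opNorm_mul _ _).trans
                (mul_le_mul_of_nonneg_right (Matrix.l2_opNorm_mul _ _) (norm_nonneg _))
          _ ≤ K₁ * Real.exp (-a * (t - r)) * d * (K₂ * Real.exp (-a * (r - s))) := by
              have := h₁ r t hr0 hr.2
              have := h₂ s r hs hr.1.le
              have := hDd r hr0
              gcongr
          _ = _ := by rw [h4, Real.exp_add]; ring
      rw [intervalIntegral.integral_const, smul_eq_mul] at h3
      have h5 := mul_le_mul_of_nonneg_left (mul_exp_neg_le (x := t - s) ha)
        (show 0 ≤ K₁ * K₂ * d by positivity)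
      linarith
    have hA := (h₁ s t hs hst).trans (mul_le_mul_of_nonneg_left hle hK₁)
    have hB := (h₂ s t hs hst).trans (mul_le_mul_of_nonneg_left hle hK₂)
    have hE := Real.exp_nonneg (-(a / 2) * (t - s))
    linarith

end Cascade

/-! ### Observability of the antistable block gives detectability -/

section Detectability

variable {α β ο : Type*} [Fintype α] [DecidableEq α] [Fintype β] [DecidableEq β]
  [Fintype ο] [DecidableEq ο]
  {B₁₁ : ℝ → Matrix α α ℝ} {B₁₂ : ℝ → Matrix α β ℝ} {B₂₂ : ℝ → Matrix β β ℝ}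
  {C₁ : ℝ → Matrix ο α ℝ} {C₂ : ℝ → Matrix ο β ℝ} {Y₁ : ℝ → Matrix α α ℝ}
  {Y₂ : ℝ → Matrix β β ℝ}

/-- Injecting the output into the antistable block only keeps the error system block triangular, so
that the gain of `exists_stabilizing_gain` suffices. -/
theorem detectableCont_of_uniformlyCompletelyObservable
    (cB₁₁ : ContinuousOn B₁₁ (Ici 0)) (cB₁₂ : ContinuousOn B₁₂ (Ici 0))
    (cB₂₂ : ContinuousOn B₂₂ (Ici 0)) (cC₁ : ContinuousOn C₁ (Ici 0))
    (cC₂ : ContinuousOn C₂ (Ici 0)) (bB₁₁ : UniformlyBounded B₁₁) (bB₁₂ : UniformlyBounded B₁₂)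
    (bC₁ : UniformlyBounded C₁) (bC₂ : UniformlyBounded C₂)
    (hY₁ : IsFundamentalMatrix B₁₁ Y₁) (hY₂ : IsFundamentalMatrix B₂₂ Y₂)
    {K a : ℝ} (hK : 1 ≤ K) (ha : 0 < a)
    (hanti : ∀ t t₀, 0 ≤ t → t ≤ t₀ →
      ‖transitionMatrix Y₁ t t₀‖ ≤ K * Real.exp (a * (t - t₀)))
    (hstab : ∀ t₀ t, 0 ≤ t₀ → t₀ ≤ t →
      ‖transitionMatrix Y₂ t t₀‖ ≤ K * Real.exp (-a * (t - t₀)))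
    (hobs : UniformlyCompletelyObservable B₁₁ C₁) :
    UniformlyExponentiallyDetectableCont
      (fun t => Matrix.fromBlocks (B₁₁ t) (B₁₂ t) 0 (B₂₂ t))
      (fun t => Matrix.fromCols (C₁ t) (C₂ t)) := by
  obtain ⟨Y, hY, β₁, β₂, σ, hβ₁, -, hσ, hG⟩ := hobs
  have hanti' : ∀ t t₀, 0 ≤ t → t ≤ t₀ →
      ‖transitionMatrix Y t t₀‖ ≤ K * Real.exp (a * (t - t₀)) := fun t t₀ ht htt => by
    rw [transitionMatrix_unique hY hY₁ bB₁₁ (ht.trans htt) ht]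
    exact hanti t t₀ ht htt
  obtain ⟨L, cL, bL, Z, hZ, K', hK', hZstab⟩ := exists_stabilizing_gain hY cB₁₁ cC₁ bB₁₁ bC₁ hK ha
    hanti' hβ₁ hσ fun t₀ h₀ => (posSemidef_sub_smul_one_iff
      (observabilityGramian_isHermitian hY cC₁ h₀ (by positivity)) β₁).1 (hG t₀ h₀).1
  refine ⟨fun t => Matrix.fromRows (L t) 0, ?_, ?_, ?_⟩
  · have h : ∀ t, Matrix.fromRows (L t) (0 : Matrix β ο ℝ) = inlMat α β * L t := fun t => by
      simp [inlMat, Matrix.fromRows_mul]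
    simp_rw [h]
    exact continuousOn_const.matrix_mul cL
  · obtain ⟨ℓ, hℓ⟩ := bL
    exact ⟨ℓ, fun t ht => (norm_fromRows_zero_le _).trans (hℓ t ht)⟩
  · have e : ∀ t, Matrix.fromBlocks (B₁₁ t) (B₁₂ t) 0 (B₂₂ t) -
        Matrix.fromRows (L t) 0 * Matrix.fromCols (C₁ t) (C₂ t) =
        Matrix.fromBlocks (B₁₁ t - L t * C₁ t) (B₁₂ t - L t * C₂ t) 0 (B₂₂ t) := fun t => by
      rw [Matrix.fromRows_mul_fromCols, sub_eq_iff_eq_add, Matrix.fromBlocks_add]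
      simp
    simp_rw [e]
    exact uniformlyExponentiallyStable_fromBlocks hZ hY₂ (cB₁₁.sub (cL.matrix_mul cC₁))
      (cB₁₂.sub (cL.matrix_mul cC₂)) cB₂₂ (uniformlyBounded_sub_mul bB₁₂ bL bC₂) hK'
      (zero_le_one.trans hK) ha hZstab hstab

end Detectability

end LTV

theorem theorem1 (m k p : ℕ)
    (B₁₁ : ℝ → Matrix (Fin m) (Fin m) ℝ) (B₁₂ : ℝ → Matrix (Fin m) (Fin k) ℝ)
    (B₂₂ : ℝ → Matrix (Fin k) (Fin k) ℝ)
    (C₁ : ℝ → Matrix (Fin p) (Fin m) ℝ) (C₂ : ℝ → Matrix (Fin p) (Fin k) ℝ)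
    (cB₁₁ : ContinuousOn B₁₁ (Set.Ici 0)) (cB₁₂ : ContinuousOn B₁₂ (Set.Ici 0))
    (cB₂₂ : ContinuousOn B₂₂ (Set.Ici 0))
    (cC₁ : ContinuousOn C₁ (Set.Ici 0)) (cC₂ : ContinuousOn C₂ (Set.Ici 0))
    (bB₁₁ : UniformlyBounded B₁₁) (bB₁₂ : UniformlyBounded B₁₂) (bB₂₂ : UniformlyBounded B₂₂)
    (bC₁ : UniformlyBounded C₁) (bC₂ : UniformlyBounded C₂)
    (X : ℝ → Matrix (Fin m ⊕ Fin k) (Fin m ⊕ Fin k) ℝ)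
    (hX : ∀ t : ℝ, 0 ≤ t → (X t).toBlocks₂₁ = 0)
    (hED : ExponentialDichotomyWith
      (fun t => Matrix.fromBlocks (B₁₁ t) (B₁₂ t) 0 (B₂₂ t)) X (Matrix.fromBlocks 0 0 0 1)) :
    (UniformlyExponentiallyDetectable
        (fun t => Matrix.fromBlocks (B₁₁ t) (B₁₂ t) 0 (B₂₂ t))
        (fun t => Matrix.fromCols (C₁ t) (C₂ t)) ↔
      UniformlyCompletelyObservable B₁₁ C₁) ∧
    (UniformlyExponentiallyDetectableCont
        (fun t => Matrix.fromBlocks (B₁₁ t) (B₁₂ t) 0 (B₂₂ t))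
        (fun t => Matrix.fromCols (C₁ t) (C₂ t)) ↔
      UniformlyCompletelyObservable B₁₁ C₁) := by
  obtain ⟨hF, -, K, a, hK, ha, hP, hQ⟩ := hED
  have hstab : ∀ t₀ t, 0 ≤ t₀ → t₀ ≤ t →
      ‖transitionMatrix (fun s => (X s).toBlocks₂₂) t t₀‖ ≤ K * Real.exp (-a * (t - t₀)) :=
    fun t₀ t h₀ ht => (LTV.norm_transitionMatrix_toBlocks₂₂_le (hF.isUnit h₀) (hX t₀ h₀)
      (hX t (h₀.trans ht))).trans (hP t t₀ h₀ ht)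
  have hanti : ∀ t t₀, 0 ≤ t → t ≤ t₀ →
      ‖transitionMatrix (fun s => (X s).toBlocks₁₁) t t₀‖ ≤ K * Real.exp (a * (t - t₀)) :=
    fun t t₀ h₀ ht => (LTV.norm_transitionMatrix_toBlocks₁₁_le (hF.isUnit (h₀.trans ht))
      (hX t₀ (h₀.trans ht)) (hX t h₀)).trans (hQ t t₀ h₀ ht)
  have necessity := LTV.uniformlyCompletelyObservable_of_detectable cC₁ cC₂ bB₁₁ bB₁₂ bB₂₂ bC₁ bC₂
    hF hX hK ha hanti
  have sufficiency := LTV.detectableCont_of_uniformlyCompletelyObservable cB₁₁ cB₁₂ cB₂₂ cC₁ cC₂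
    bB₁₁ bB₁₂ bC₁ bC₂ (LTV.isFundamentalMatrix_toBlocks₁₁ hF hX)
    (LTV.isFundamentalMatrix_toBlocks₂₂ hF hX) hK ha hanti hstab
  refine ⟨⟨necessity, fun h => ?_⟩, ⟨fun h => necessity ?_, sufficiency⟩⟩
  · obtain ⟨L, -, hL⟩ := sufficiency h
    exact ⟨L, hL⟩
  · obtain ⟨L, -, hL⟩ := h
    exact ⟨L, hL⟩
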